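/- Let $\alpha\ge 1$ and $0\le p<1$. Let $m$ be Lebesgue measure on $\mathbb{C}$, let $m_{\mathbb{T}}$ be the uniform probability measure on the unit circle $\{|z|=1\}$, and let $D=\{|z|<1\}$ be the open unit disk. For a Borel probability measure $\nu$ on $\mathbb{C}$ put $$U_\nu(z)=\int \log|z-w|\,\mathrm{d}\nu(w),\qquad \Sigma(\nu)=\iint \log|z-w|\,\mathrm{d}\nu(z)\,\mathrm{d}\nu(w),$$ with $\log 0=-\infty$, and $$I_\alpha(\nu)=\int_{\mathbb{C}}\frac{|z|^2}{\alpha}\,\mathrm{d}\nu(z)-\Sigma(\nu)\in(-\infty,+\infty],$$ where $I_\alpha(\nu)=+\infty$ if $\int|z|^2\,\mathrm{d}\nu=\infty$. Let $\mathcal{F}_p$ be the set of Borel probability measures $\mu$ on $\mathbb{C}$ with $\mu(D)\le p/\alpha$, and let $$\overline{\mu}_p^\alpha=\frac1\alpha\left(\mathbb{1}_{\{|z|\le\sqrt p\}}+\mathbb{1}_{\{1\le|z|\le\sqrt\alpha\}}\right)\frac{m}{\pi}+\frac{1-p}{\alpha}\,m_{\mathbb{T}}.$$ Then $\overline{\mu}_p^\alpha$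 is a probability measure belonging to $\mathcal{F}_p$, $I_\alpha(\overline{\mu}_p^\alpha)$ is finite, and $\overline{\mu}_p^\alpha$ is the unique minimizer of $I_\alpha$ over $\mathcal{F}_p$: for every $\nu\in\mathcal{F}_p$ with $\nu\ne\overline{\mu}_p^\alpha$, $$I_\alpha(\overline{\mu}_p^\alpha)<I_\alpha(\nu).$$ Moreover, with $c_1=\frac{p(\log p-1)+1}{2\alpha}$ (where $0\log 0=0$), one has $c_1>0$ and $$U_{\overline{\mu}_p^\alpha}(z)=\frac{|z|^2}{2\alpha}+\frac{\log\alpha-1}{2}+\begin{cases}c_1,& |z|\le\sqrt p,\\ 0,& 1\le|z|\le\sqrt\alpha,\end{cases}$$ $$U_{\overline{\mu}_p^\alpha}(z)<\frac{|z|^2}{2\alpha}+\frac{\log\alpha-1}{2}+\begin{cases}c_1,& \sqrt p<|z|<1,\\ 0,& |z|>\sqrt\alpha.\end{cases}$$ -/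

import Mathlib

open MeasureTheory

noncomputable section

namespace Ginibre

/-- Integral of an extended-real function, `∫ f⁺ dμ - ∫ f⁻ dμ`, with value in `[-∞, ∞]`.
It is the usual integral whenever one of the two terms is finite. -/
def eintegral {X : Type*} [MeasurableSpace X] (μ : Measure X) (f : X → EReal) : EReal :=
  ((∫⁻ x, (f x).toENNReal ∂μ : ENNReal) : EReal) -
    ((∫⁻ x, (-f x).toENNReal ∂μ : ENNReal) : EReal)

/-- The kernel `log |z - w|`, equal to `-∞` on the diagonal. -/
def logKernel (z w : ℂ) : EReal := ENNReal.log ‖z - w‖ₑ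

/-- The logarithmic potential `U_μ(z) = ∫ log |z - w| dμ(w)`. -/
def logPotential (μ : Measure ℂ) (z : ℂ) : EReal := eintegral μ fun w => logKernel z w

/-- The logarithmic energy `Σ(μ) = ∬ log |z - w| dμ(z) dμ(w)`. -/
def logEnergy (μ : Measure ℂ) : EReal := eintegral (μ.prod μ) fun x => logKernel x.1 x.2

open Classical in
/-- The functional `I_α(ν) = ∫ |z|² / α dν(z) - Σ(ν)`, with the value `+∞` if `∫ |z|² dν = ∞`.
If `ν` is a probability measure with `∫ |z|² dν < ∞` then `log⁺ |z - w|` is integrable for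
`ν ⊗ ν`, so `Σ(ν)` is a well-defined element of `[-∞, ∞)`. -/
def weightedEnergy (α : ℝ) (ν : Measure ℂ) : EReal :=
  if ∫⁻ z, ENNReal.ofReal (‖z‖ ^ 2 / α) ∂ν = ⊤ then ⊤
  else ((∫⁻ z, ENNReal.ofReal (‖z‖ ^ 2 / α) ∂ν : ENNReal) : EReal) - logEnergy ν

/-- The uniform probability measure on the unit circle: the law of `e^{iθ}` for `θ` uniform
on `(0, 2π]`. -/
def unitCircleMeasure : Measure ℂ :=
  Measure.map (circleMap 0 1)
    ((ENNReal.ofReal (2 * Real.pi))⁻¹ • (volume.restrict (Set.Ioc (0 : ℝ) (2 * Real.pi))))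

/-- `μ_p^α = (1_{|z| ≤ √p} + 1_{1 ≤ |z| ≤ √α}) m / π + (1 - p) m_𝕋`. -/
def deficiencyMeasure (p α : ℝ) : Measure ℂ :=
  (ENNReal.ofReal Real.pi)⁻¹ •
      (volume.restrict {z : ℂ | ‖z‖ ≤ √p} + volume.restrict {z : ℂ | 1 ≤ ‖z‖ ∧ ‖z‖ ≤ √α}) +
    ENNReal.ofReal (1 - p) • unitCircleMeasure

/-- The normalized measure `(1/α) μ_p^α`. -/
def normalizedDeficiencyMeasure (p α : ℝ) : Measure ℂ :=
  (ENNReal.ofReal α)⁻¹ • deficiencyMeasure p α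

/-- `F_p(α)`: the Borel probability measures on `ℂ` giving the open unit disk mass at most
`p / α`. -/
def deficiencySet (p α : ℝ) : Set (Measure ℂ) :=
  {μ | IsProbabilityMeasure μ ∧ μ {z : ℂ | ‖z‖ < 1} ≤ ENNReal.ofReal (p / α)}

/-- The constant `c₁ = (p (log p - 1) + 1) / (2α)`. -/
def potentialGap (p α : ℝ) : ℝ := (p * (Real.log p - 1) + 1) / (2 * α)

end Ginibre

end

/-! This is convex duality for the energy functional. Write μ for the candidate, U for its
potential, D for the open unit disk, k = (log α - 1)/2, and Σ(ν, μ) = ∫ U dν for the mutual energy.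

Two facts carry the argument. First, U ≤ |z|²/(2α) + k + c₁ 1_D everywhere, with equality μ-almost
everywhere (`deficiencyPotential_le`, `deficiencyPotential_ae_eq`); c₁ > 0 is the Lagrange
multiplier of the constraint on D. Second, Σ(ν) + Σ(μ) < 2 Σ(ν, μ) for ν ≠ μ whenever these energies
are finite (`log_energy_lt`). Hence I(ν) > ∫|z|²/α dν - 2∫U dν + Σ(μ) ≥ Σ(μ) - 2k - 2c₁ ν(D) ≥ Σ(μ)
- 2k - 2c₁ p/α. Since μ(D) = p/α, equality in the first fact makes the last expression I(μ).

The second fact comes from Frullani's formula log q = ∫₀^∞ (e^{-t} - e^{-tq}) dt/t at q = |z - w|².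
The e^{-t} terms cancel between probability measures, leaving the Gaussian energies of ν - μ, which
are positive by Fourier inversion. The first fact is an explicit radial computation: the mean of
log|z - w| over |w| = r is log max(r, |z|). -/

namespace Ginibre

/-! ### Strict negative definiteness of the logarithmic kernel. -/

section Energy

open Filter Topology ComplexConjugate Set

theorem integrable_exp_neg_mul_sq_norm {b : ℝ} (hb : 0 < b) :
    Integrable (fun ξ : ℂ => Real.exp (-b * ‖ξ‖ ^ 2)) := by
  have hbre : 0 < ((b : ℂ)).re := by simpa using hb
  have := (GaussianFourier.integrable_cexp_neg_mul_sq_norm_add hbre 0 (0 : ℂ)).re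
  refine this.congr (Eventually.of_forall fun ξ => ?_)
  simp only [zero_mul, add_zero]
  have : (-(b : ℂ) * ‖ξ‖ ^ 2) = ((-b * ‖ξ‖ ^ 2 : ℝ) : ℂ) := by push_cast; ring
  rw [this, ← Complex.ofReal_exp]; exact Complex.ofReal_re _

/-- The Gaussian energy of two measures, written in terms of their characteristic functions. -/
theorem integral_gaussian_prod_eq (ν μ : Measure ℂ) [IsProbabilityMeasure ν]
    [IsProbabilityMeasure μ] {t : ℝ} (ht : 0 < t) :
    ∫ x, Real.exp (-t * ‖x.1 - x.2‖ ^ 2) ∂(ν.prod μ) =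
      (4 * Real.pi * t)⁻¹ * ∫ ξ : ℂ, Real.exp (-(4 * t)⁻¹ * ‖ξ‖ ^ 2) *
        (charFun ν ξ * conj (charFun μ ξ)).re := by
  -- With this b the planar transform of exp(-b|ξ|²), which is (π/b) exp(-|x|²/(4b)), equals 4πt
  -- exp(-t|x|²).
  set b : ℝ := (4 * t)⁻¹ with hb
  have hb0 : 0 < b := by positivity
  have hbre : 0 < ((b : ℂ)).re := by simpa using hb0
  have hpi := Real.pi_pos
  have hint : Integrable (Function.uncurry fun (x : ℂ × ℂ) (ξ : ℂ) =>
      Complex.exp (-(b : ℂ) * ‖ξ‖ ^ 2 + Complex.I * (inner ℝ (x.1 - x.2) ξ : ℝ)))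
      ((ν.prod μ).prod volume) := by
    have h0 := integrable_exp_neg_mul_sq_norm hb0
    have h1 : Integrable (fun q : (ℂ × ℂ) × ℂ => Real.exp (-b * ‖q.2‖ ^ 2))
      ((ν.prod μ).prod volume) := h0.comp_snd _
    refine h1.mono' (Continuous.aestronglyMeasurable (by fun_prop)) (Eventually.of_forall fun q => ?_)
    simp only [Function.uncurry, Complex.norm_exp]
    apply le_of_eq
    congr 1
    simp [← Complex.ofReal_pow]
  have hpt : ∀ x : ℂ × ℂ, ((Real.exp (-t * ‖x.1 - x.2‖ ^ 2) : ℝ) : ℂ) =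
      ((4 * Real.pi * t)⁻¹ : ℝ) * ∫ ξ : ℂ,
        Complex.exp (-(b : ℂ) * ‖ξ‖ ^ 2 + Complex.I * (inner ℝ (x.1 - x.2) ξ : ℝ)) := by
    intro x
    rw [GaussianFourier.integral_cexp_neg_mul_sq_norm_add hbre Complex.I (x.1 - x.2)]
    have e1 : ((Module.finrank ℝ ℂ : ℂ) / 2) = 1 := by
      rw [Complex.finrank_real_complex]; norm_num
    have e2 : Complex.I ^ 2 * (‖x.1 - x.2‖ : ℂ) ^ 2 / (4 * (b : ℂ)) =
        ((-t * ‖x.1 - x.2‖ ^ 2 : ℝ) : ℂ) := by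
      rw [Complex.I_sq, hb]; push_cast
      have : (t : ℂ) ≠ 0 := by exact_mod_cast ht.ne'
      field_simp
    rw [e1, e2, Complex.cpow_one, ← Complex.ofReal_exp, ← mul_assoc]
    have e3 : (((4 * Real.pi * t)⁻¹ : ℝ) : ℂ) * ((Real.pi : ℂ) / (b : ℂ)) = 1 := by
      rw [← Complex.ofReal_div, ← Complex.ofReal_mul, hb]
      norm_cast
      field_simp
    rw [e3, one_mul]
  have hin : ∀ ξ : ℂ, ∫ x : ℂ × ℂ,
        Complex.exp (-(b : ℂ) * ‖ξ‖ ^ 2 + Complex.I * (inner ℝ (x.1 - x.2) ξ : ℝ)) ∂(ν.prod μ) =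
      (Real.exp (-b * ‖ξ‖ ^ 2) : ℝ) * (charFun ν ξ * conj (charFun μ ξ)) := by
    intro ξ
    rw [← charFun_neg, charFun_apply, charFun_apply, ← integral_prod_mul, ← integral_const_mul]
    congr 1; ext x
    rw [Complex.ofReal_exp, ← Complex.exp_add, ← Complex.exp_add]
    congr 1
    rw [inner_sub_left, inner_neg_right]
    push_cast; ring
  have key : ((∫ x, Real.exp (-t * ‖x.1 - x.2‖ ^ 2) ∂(ν.prod μ) : ℝ) : ℂ) =
      ((4 * Real.pi * t)⁻¹ : ℝ) * ∫ ξ : ℂ, (Real.exp (-b * ‖ξ‖ ^ 2) : ℝ) *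
        (charFun ν ξ * conj (charFun μ ξ)) := by
    rw [← integral_complex_ofReal]
    simp_rw [hpt]
    rw [integral_const_mul, integral_integral_swap hint]
    simp_rw [hin]
  have hint2 : Integrable (fun ξ : ℂ => ((Real.exp (-b * ‖ξ‖ ^ 2) : ℝ) : ℂ) *
        (charFun ν ξ * conj (charFun μ ξ))) := by
    refine hint.integral_prod_right.congr (Eventually.of_forall fun ξ => ?_)
    exact hin ξ
  have := congrArg Complex.re key
  rw [Complex.ofReal_re, Complex.re_ofReal_mul] at this
  rw [this]
  congr 1
  have h2 := integral_re hint2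
  rw [show (∫ ξ : ℂ, ((Real.exp (-b * ‖ξ‖ ^ 2) : ℝ) : ℂ) *
        (charFun ν ξ * conj (charFun μ ξ))).re = RCLike.re (∫ ξ : ℂ, ((Real.exp (-b * ‖ξ‖ ^ 2) : ℝ) : ℂ) *
        (charFun ν ξ * conj (charFun μ ξ))) from rfl, ← h2]
  congr 1; ext ξ
  exact Complex.re_ofReal_mul _ _

/-- The Gaussian kernel is strictly positive definite on measures. -/
theorem gaussian_energy_pos {ν μ : Measure ℂ} [IsProbabilityMeasure ν]
    [IsProbabilityMeasure μ] (hne : ν ≠ μ) {t : ℝ} (ht : 0 < t) :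
    0 < ∫ x, Real.exp (-t * ‖x.1 - x.2‖ ^ 2) ∂(ν.prod ν) +
      ∫ x, Real.exp (-t * ‖x.1 - x.2‖ ^ 2) ∂(μ.prod μ) -
      2 * ∫ x, Real.exp (-t * ‖x.1 - x.2‖ ^ 2) ∂(ν.prod μ) := by
  simp_rw [integral_gaussian_prod_eq _ _ ht]
  have hb0 : 0 < (4 * t)⁻¹ := by positivity
  have hI : ∀ (ν μ : Measure ℂ) [IsProbabilityMeasure ν] [IsProbabilityMeasure μ],
      Integrable (fun ξ : ℂ => Real.exp (-(4 * t)⁻¹ * ‖ξ‖ ^ 2) *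
        (charFun ν ξ * conj (charFun μ ξ)).re) := by
    intro ν μ _ _
    refine (integrable_exp_neg_mul_sq_norm hb0).mono' ?_ (Eventually.of_forall fun ξ => ?_)
    · have := continuous_charFun (μ := ν)
      have := continuous_charFun (μ := μ)
      exact Continuous.aestronglyMeasurable (by fun_prop)
    · rw [norm_mul, Real.norm_of_nonneg (Real.exp_pos _).le]
      refine mul_le_of_le_one_right (Real.exp_pos _).le ((Complex.abs_re_le_norm _).trans ?_)
      rw [norm_mul, RCLike.norm_conj]
      exact mul_le_one₀ (norm_charFun_le_one ξ) (norm_nonneg _) (norm_charFun_le_one ξ)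
  -- Polarization: the three terms combine into the Gaussian-weighted integral of |φ_ν - φ_μ|², with
  -- φ the characteristic functions.
  have hsum : (4 * Real.pi * t)⁻¹ * (∫ ξ : ℂ, Real.exp (-(4 * t)⁻¹ * ‖ξ‖ ^ 2) *
        (charFun ν ξ * conj (charFun ν ξ)).re) +
      (4 * Real.pi * t)⁻¹ * (∫ ξ : ℂ, Real.exp (-(4 * t)⁻¹ * ‖ξ‖ ^ 2) *
        (charFun μ ξ * conj (charFun μ ξ)).re) -
      2 * ((4 * Real.pi * t)⁻¹ * ∫ ξ : ℂ, Real.exp (-(4 * t)⁻¹ * ‖ξ‖ ^ 2) *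
        (charFun ν ξ * conj (charFun μ ξ)).re) =
      (4 * Real.pi * t)⁻¹ * ∫ ξ : ℂ, Real.exp (-(4 * t)⁻¹ * ‖ξ‖ ^ 2) *
        Complex.normSq (charFun ν ξ - charFun μ ξ) := by
    have : ∀ ξ : ℂ, Real.exp (-(4 * t)⁻¹ * ‖ξ‖ ^ 2) *
        Complex.normSq (charFun ν ξ - charFun μ ξ) =
        (Real.exp (-(4 * t)⁻¹ * ‖ξ‖ ^ 2) * (charFun ν ξ * conj (charFun ν ξ)).re +
        Real.exp (-(4 * t)⁻¹ * ‖ξ‖ ^ 2) * (charFun μ ξ * conj (charFun μ ξ)).re) -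
        2 * (Real.exp (-(4 * t)⁻¹ * ‖ξ‖ ^ 2) * (charFun ν ξ * conj (charFun μ ξ)).re) := by
      intro ξ
      rw [Complex.normSq_sub, Complex.mul_conj, Complex.mul_conj, Complex.ofReal_re,
        Complex.ofReal_re]
      ring
    simp_rw [this]
    have h2 := integral_sub ((hI ν ν).add (hI μ μ)) ((hI ν μ).const_mul 2)
    have h3 := integral_add (hI ν ν) (hI μ μ)
    simp only [Pi.add_apply] at h2 h3
    rw [h2, h3, integral_const_mul]
    ring
  rw [hsum]
  have hc : Continuous fun ξ : ℂ => Real.exp (-(4 * t)⁻¹ * ‖ξ‖ ^ 2) *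
        Complex.normSq (charFun ν ξ - charFun μ ξ) := by
    have := continuous_charFun (μ := ν)
    have := continuous_charFun (μ := μ)
    have := Complex.continuous_normSq
    fun_prop
  have hpi := Real.pi_pos
  refine mul_pos (by positivity) ?_
  obtain ⟨ξ, hξ⟩ : ∃ ξ, charFun ν ξ ≠ charFun μ ξ := by
    by_contra! h
    exact hne (Measure.ext_of_charFun (funext h))
  refine integral_pos_of_integrable_nonneg_nonzero (x := ξ) hc ?_ (fun ξ => ?_) ?_
  · have h2 := ((hI ν ν).add (hI μ μ)).sub ((hI ν μ).const_mul 2)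
    refine h2.congr (Eventually.of_forall fun ξ => ?_)
    simp only [Pi.add_apply, Pi.sub_apply]
    rw [Complex.normSq_sub, Complex.mul_conj, Complex.mul_conj, Complex.ofReal_re,
      Complex.ofReal_re]
    ring
  · exact mul_nonneg (Real.exp_pos _).le (Complex.normSq_nonneg _)
  · exact mul_ne_zero (Real.exp_pos _).ne' (by simpa [sub_eq_zero] using hξ)

/-- The truncation of the Frullani integral for `log q`. -/
noncomputable def frullaniTrunc (n : ℕ) (q : ℝ) : ℝ :=
  ∫ t in ((n : ℝ) + 1)⁻¹..(n + 1), t⁻¹ * (Real.exp (-t) - Real.exp (-t * q))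

theorem inv_succ_le_succ (n : ℕ) : ((n : ℝ) + 1)⁻¹ ≤ n + 1 := by
  have h : (1 : ℝ) ≤ n + 1 := by simp
  exact (inv_le_one_of_one_le₀ h).trans h

/-- Frullani's integral for f(t) = e^{-t}, which tends to 1 at 0⁺ and to 0 at infinity. -/
theorem tendsto_frullaniTrunc {q : ℝ} (hq : 0 < q) :
    Tendsto (fun n => frullaniTrunc n q) atTop (𝓝 (Real.log q)) := by
  have hc : Continuous fun t : ℝ => Real.exp (-t) := by fun_prop
  have h := Frullani.tendsto_intervalIntegral (f := fun t : ℝ => Real.exp (-t)) (L := 1) (R := 0)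
    (a := 1) (b := q) (hc.locallyIntegrable.locallyIntegrableOn _)
    one_pos hq (by simpa using (hc.tendsto 0).mono_left nhdsWithin_le_nhds)
    Real.tendsto_exp_neg_atTop_nhds_zero
  have h1 : Tendsto (fun n : ℕ => ((n : ℝ) + 1)) atTop atTop :=
    tendsto_atTop_add_const_right _ _ tendsto_natCast_atTop_atTop
  have h2 : Tendsto (fun n : ℕ => (((n : ℝ) + 1)⁻¹, ((n : ℝ) + 1))) atTop
      ((𝓝[>] 0) ×ˢ atTop) :=
    (tendsto_inv_atTop_nhdsGT_zero.comp h1).prodMk h1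
  have h3 := h.comp h2
  simp only [div_one, sub_zero, smul_eq_mul, mul_one, one_mul] at h3
  refine h3.congr fun n => ?_
  simp only [Function.comp, frullaniTrunc, neg_mul, mul_comm q]

theorem intervalIntegrable_frullani (n : ℕ) (q : ℝ) :
    IntervalIntegrable (fun t => t⁻¹ * (Real.exp (-t) - Real.exp (-t * q))) volume
      ((n : ℝ) + 1)⁻¹ (n + 1) := by
  have hp : (0 : ℝ) < ((n : ℝ) + 1)⁻¹ := by positivity
  refine ContinuousOn.intervalIntegrable ?_
  refine ContinuousOn.mul (continuousOn_inv₀.mono fun t ht => ?_) (by fun_prop)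
  rw [uIcc_of_le (inv_succ_le_succ n)] at ht
  exact (hp.trans_le ht.1).ne'

theorem monotone_intervalIntegral_of_nonneg {f : ℝ → ℝ} (hf : ∀ t, 0 < t → 0 ≤ f t)
    (hi : ∀ n : ℕ, IntervalIntegrable f volume ((n : ℝ) + 1)⁻¹ (n + 1)) :
    Monotone fun n : ℕ => ∫ t in ((n : ℝ) + 1)⁻¹..(n + 1), f t := by
  intro m n hmn
  have h0 : (m : ℝ) ≤ n := by exact_mod_cast hmn
  have hp : (0 : ℝ) < ((n : ℝ) + 1)⁻¹ := by positivity
  refine intervalIntegral.integral_mono_interval (by gcongr) (inv_succ_le_succ m)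
    (by gcongr) ?_ (hi n)
  exact (ae_restrict_iff' measurableSet_Ioc).2 (Eventually.of_forall fun t ht => hf t (hp.trans ht.1))

/-- The integrand has one sign on t > 0, decided by q ≥ 1 or q ≤ 1, so the truncations move
monotonically away from 0 towards log q. This makes |log q| a dominating function. -/
theorem abs_frullaniTrunc_le {q : ℝ} (hq : 0 < q) (n : ℕ) :
    |frullaniTrunc n q| ≤ |Real.log q| := by
  have hlim := tendsto_frullaniTrunc hq
  have hp : (0 : ℝ) < ((n : ℝ) + 1)⁻¹ := by positivity
  rcases le_total 1 q with h | h
  · have hf : ∀ t : ℝ, 0 < t → 0 ≤ t⁻¹ * (Real.exp (-t) - Real.exp (-t * q)) := fun t ht =>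
      mul_nonneg (by positivity) (sub_nonneg.2 (Real.exp_le_exp.2 (by nlinarith)))
    have hm := monotone_intervalIntegral_of_nonneg hf
      fun n => intervalIntegrable_frullani n q
    have h1 : frullaniTrunc n q ≤ Real.log q := hm.ge_of_tendsto hlim n
    have h0 : 0 ≤ frullaniTrunc n q :=
      intervalIntegral.integral_nonneg (inv_succ_le_succ n) fun t ht => hf t (hp.trans_le ht.1)
    rwa [abs_of_nonneg h0, abs_of_nonneg (h0.trans h1)]
  · have hf : ∀ t : ℝ, 0 < t → 0 ≤ -(t⁻¹ * (Real.exp (-t) - Real.exp (-t * q))) := fun t ht => by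
      rw [← mul_neg]
      exact mul_nonneg (by positivity)
        (by rw [neg_sub]; exact sub_nonneg.2 (Real.exp_le_exp.2 (by nlinarith)))
    have hm := monotone_intervalIntegral_of_nonneg hf
      fun n => (intervalIntegrable_frullani n q).neg
    have h1 : -frullaniTrunc n q ≤ -Real.log q := by
      refine Monotone.ge_of_tendsto (f := fun n => -frullaniTrunc n q) ?_ hlim.neg n
      simpa only [frullaniTrunc, ← intervalIntegral.integral_neg] using hm
    have h0 : 0 ≤ -frullaniTrunc n q := by
      rw [frullaniTrunc, ← intervalIntegral.integral_neg]
      exact intervalIntegral.integral_nonneg (inv_succ_le_succ n) fun t ht => hf t (hp.trans_le ht.1)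
    rw [abs_of_nonpos (by linarith), abs_of_nonpos (by linarith)]
    exact h1

/-- Fubini for the truncated logarithmic energy. -/
theorem integral_frullaniTrunc (ρ : Measure (ℂ × ℂ)) [IsProbabilityMeasure ρ] (n : ℕ) :
    IntervalIntegrable (fun t => t⁻¹ * (Real.exp (-t) -
      ∫ x, Real.exp (-t * ‖x.1 - x.2‖ ^ 2) ∂ρ)) volume ((n : ℝ) + 1)⁻¹ (n + 1) ∧
    ∫ x, frullaniTrunc n (‖x.1 - x.2‖ ^ 2) ∂ρ =
      ∫ t in ((n : ℝ) + 1)⁻¹..(n + 1),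
        t⁻¹ * (Real.exp (-t) - ∫ x, Real.exp (-t * ‖x.1 - x.2‖ ^ 2) ∂ρ) := by
  have hp : (0 : ℝ) < ((n : ℝ) + 1)⁻¹ := by positivity
  have hmeas : Measurable (fun q : (ℂ × ℂ) × ℝ =>
      q.2⁻¹ * (Real.exp (-q.2) - Real.exp (-q.2 * ‖q.1.1 - q.1.2‖ ^ 2))) := by fun_prop
  have hint : Integrable (Function.uncurry fun (x : ℂ × ℂ) (t : ℝ) =>
      t⁻¹ * (Real.exp (-t) - Real.exp (-t * ‖x.1 - x.2‖ ^ 2)))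
      (ρ.prod (volume.restrict (Ioc ((n : ℝ) + 1)⁻¹ (n + 1)))) := by
    -- On the truncated interval 1/t ≤ n + 1, and two numbers in [0, 1] differ by at most 1.
    refine Integrable.of_bound hmeas.aestronglyMeasurable ((n : ℝ) + 1) ?_
    have hae : ∀ᵐ q ∂(ρ.prod (volume.restrict (Ioc ((n : ℝ) + 1)⁻¹ (n + 1)))),
        q.2 ∈ Ioc ((n : ℝ) + 1)⁻¹ (n + 1) :=
      Measure.quasiMeasurePreserving_snd.ae (ae_restrict_mem measurableSet_Ioc)
    filter_upwards [hae] with q hq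
    have ht : 0 < q.2 := hp.trans hq.1
    simp only [Function.uncurry]
    rw [norm_mul, norm_inv, Real.norm_of_nonneg ht.le, Real.norm_eq_abs]
    have h1 : |Real.exp (-q.2) - Real.exp (-q.2 * ‖q.1.1 - q.1.2‖ ^ 2)| ≤ 1 := by
      have e1 := Real.exp_pos (-q.2)
      have e2 := Real.exp_pos (-q.2 * ‖q.1.1 - q.1.2‖ ^ 2)
      have e3 : Real.exp (-q.2) ≤ 1 := Real.exp_le_one_iff.2 (by linarith)
      have e4 : Real.exp (-q.2 * ‖q.1.1 - q.1.2‖ ^ 2) ≤ 1 :=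
        Real.exp_le_one_iff.2 (by nlinarith [sq_nonneg ‖q.1.1 - q.1.2‖])
      rw [abs_le]; constructor <;> linarith
    have h2 : q.2⁻¹ ≤ (n : ℝ) + 1 := (inv_le_comm₀ ht (by positivity)).2 hq.1.le
    calc q.2⁻¹ * _ ≤ ((n : ℝ) + 1) * 1 := by gcongr
      _ = _ := mul_one _
  have hin : ∀ t : ℝ, 0 < t → ∫ x, t⁻¹ * (Real.exp (-t) - Real.exp (-t * ‖x.1 - x.2‖ ^ 2)) ∂ρ =
      t⁻¹ * (Real.exp (-t) - ∫ x, Real.exp (-t * ‖x.1 - x.2‖ ^ 2) ∂ρ) := by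
    intro t ht
    rw [integral_const_mul, integral_sub (integrable_const _), integral_const]
    · simp
    · refine Integrable.of_bound (Continuous.aestronglyMeasurable (by fun_prop)) 1
        (Eventually.of_forall fun x => ?_)
      rw [Real.norm_of_nonneg (Real.exp_pos _).le]
      exact Real.exp_le_one_iff.2 (by nlinarith [sq_nonneg ‖x.1 - x.2‖])
  constructor
  · rw [intervalIntegrable_iff_integrableOn_Ioc_of_le (inv_succ_le_succ n)]
    refine hint.integral_prod_right.congr ?_
    filter_upwards [ae_restrict_mem measurableSet_Ioc] with t ht
    exact hin t (hp.trans ht.1)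
  · simp only [frullaniTrunc, intervalIntegral.integral_of_le (inv_succ_le_succ n)]
    rw [integral_integral_swap hint]
    exact setIntegral_congr_fun measurableSet_Ioc fun t ht => hin t (hp.trans ht.1)

/-- Dominated convergence. The diagonal must be null because Frullani's formula needs q > 0, while
`Real.log 0 = 0`. The factor 2 comes from q being the squared distance. -/
theorem tendsto_integral_frullaniTrunc {ρ : Measure (ℂ × ℂ)}
    (hne : ∀ᵐ x ∂ρ, x.1 ≠ x.2) (hint : Integrable (fun x => Real.log ‖x.1 - x.2‖) ρ) :
    Tendsto (fun n => ∫ x, frullaniTrunc n (‖x.1 - x.2‖ ^ 2) ∂ρ) atTop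
      (𝓝 (2 * ∫ x, Real.log ‖x.1 - x.2‖ ∂ρ)) := by
  rw [← integral_const_mul]
  have hpos : ∀ᵐ x ∂ρ, 0 < ‖x.1 - x.2‖ ^ 2 := hne.mono fun x hx =>
    pow_pos (norm_pos_iff.2 (sub_ne_zero.2 hx)) 2
  have hlog : ∀ x : ℂ × ℂ, Real.log (‖x.1 - x.2‖ ^ 2) = 2 * Real.log ‖x.1 - x.2‖ := fun x => by
    rw [Real.log_pow]; norm_num
  refine tendsto_integral_of_dominated_convergence (fun x => |2 * Real.log ‖x.1 - x.2‖|)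
    (fun n => ?_) (hint.const_mul 2).abs (fun n => ?_) ?_
  · have h : StronglyMeasurable (Function.uncurry fun (x : ℂ × ℂ) (t : ℝ) =>
        t⁻¹ * (Real.exp (-t) - Real.exp (-t * ‖x.1 - x.2‖ ^ 2))) := by
      refine Measurable.stronglyMeasurable ?_
      simp only [Function.uncurry_def]
      fun_prop
    simp only [frullaniTrunc, intervalIntegral.integral_of_le (inv_succ_le_succ n)]
    exact h.integral_prod_right.aestronglyMeasurable
  · filter_upwards [hpos] with x hx
    rw [← hlog]
    exact abs_frullaniTrunc_le hx n
  · filter_upwards [hpos] with x hx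
    rw [← hlog]
    exact tendsto_frullaniTrunc hx

/-- The logarithmic energy is strictly negative definite on differences of probability measures. -/
theorem log_energy_lt {ν μ : Measure ℂ} [IsProbabilityMeasure ν] [IsProbabilityMeasure μ]
    (hne : ν ≠ μ)
    (hνν : ∀ᵐ x ∂(ν.prod ν), x.1 ≠ x.2) (hμμ : ∀ᵐ x ∂(μ.prod μ), x.1 ≠ x.2)
    (hνμ : ∀ᵐ x ∂(ν.prod μ), x.1 ≠ x.2)
    (iνν : Integrable (fun x => Real.log ‖x.1 - x.2‖) (ν.prod ν))
    (iμμ : Integrable (fun x => Real.log ‖x.1 - x.2‖) (μ.prod μ))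
    (iνμ : Integrable (fun x => Real.log ‖x.1 - x.2‖) (ν.prod μ)) :
    ∫ x, Real.log ‖x.1 - x.2‖ ∂(ν.prod ν) + ∫ x, Real.log ‖x.1 - x.2‖ ∂(μ.prod μ) <
      2 * ∫ x, Real.log ‖x.1 - x.2‖ ∂(ν.prod μ) := by
  set D : ℝ → ℝ := fun t => t⁻¹ * (∫ x, Real.exp (-t * ‖x.1 - x.2‖ ^ 2) ∂(ν.prod ν) +
      ∫ x, Real.exp (-t * ‖x.1 - x.2‖ ^ 2) ∂(μ.prod μ) -
      2 * ∫ x, Real.exp (-t * ‖x.1 - x.2‖ ^ 2) ∂(ν.prod μ)) with hD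
  have hDpos : ∀ t, 0 < t → 0 < D t := fun t ht =>
    mul_pos (inv_pos.2 ht) (gaussian_energy_pos hne ht)
  -- The e^{-t} terms cancel, with coefficients 2 - 1 - 1 = 0; inserting them makes each piece a
  -- truncated Frullani integrand.
  have hfun : D = fun t => 2 * (t⁻¹ * (Real.exp (-t) -
        ∫ x, Real.exp (-t * ‖x.1 - x.2‖ ^ 2) ∂(ν.prod μ))) -
      (t⁻¹ * (Real.exp (-t) - ∫ x, Real.exp (-t * ‖x.1 - x.2‖ ^ 2) ∂(ν.prod ν)) +
       t⁻¹ * (Real.exp (-t) - ∫ x, Real.exp (-t * ‖x.1 - x.2‖ ^ 2) ∂(μ.prod μ))) := by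
    ext t; simp only [hD]; ring
  have hDint : ∀ n : ℕ, IntervalIntegrable D volume ((n : ℝ) + 1)⁻¹ (n + 1) := fun n => by
    rw [hfun]
    exact ((integral_frullaniTrunc (ν.prod μ) n).1.const_mul 2).sub
      ((integral_frullaniTrunc (ν.prod ν) n).1.add (integral_frullaniTrunc (μ.prod μ) n).1)
  have hE : ∀ n : ℕ, 2 * ∫ x, frullaniTrunc n (‖x.1 - x.2‖ ^ 2) ∂(ν.prod μ) -
      (∫ x, frullaniTrunc n (‖x.1 - x.2‖ ^ 2) ∂(ν.prod ν) +
        ∫ x, frullaniTrunc n (‖x.1 - x.2‖ ^ 2) ∂(μ.prod μ)) =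
      ∫ t in ((n : ℝ) + 1)⁻¹..(n + 1), D t := fun n => by
    rw [hfun, intervalIntegral.integral_sub ((integral_frullaniTrunc (ν.prod μ) n).1.const_mul 2)
      ((integral_frullaniTrunc (ν.prod ν) n).1.add (integral_frullaniTrunc (μ.prod μ) n).1),
      intervalIntegral.integral_const_mul, intervalIntegral.integral_add
      (integral_frullaniTrunc (ν.prod ν) n).1 (integral_frullaniTrunc (μ.prod μ) n).1,
      (integral_frullaniTrunc _ n).2, (integral_frullaniTrunc _ n).2,
      (integral_frullaniTrunc _ n).2]
  have hmono := monotone_intervalIntegral_of_nonneg (fun t ht => (hDpos t ht).le) hDint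
  have hlim := ((tendsto_integral_frullaniTrunc hνμ iνμ).const_mul 2).sub
    ((tendsto_integral_frullaniTrunc hνν iνν).add (tendsto_integral_frullaniTrunc hμμ iμμ))
  simp_rw [hE] at hlim
  -- The index is 1 because the interval for n = 0 is the single point 1, where the integral
  -- vanishes.
  have h1 := hmono.ge_of_tendsto hlim 1
  have h2 : 0 < ∫ t in (((1 : ℕ) : ℝ) + 1)⁻¹..((1 : ℕ) + 1), D t :=
    intervalIntegral.intervalIntegral_pos_of_pos_on (hDint 1)
      (fun t ht => hDpos t (lt_trans (by positivity) ht.1)) (by norm_num)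
  have h3 := h2.trans_le h1
  linarith

end Energy

/-! ### Logarithmic potentials of circles and annuli. -/

section Potential

open Filter Topology Set

theorem continuousOn_mul_log_max {s : ℝ} (hs : 0 ≤ s) :
    ContinuousOn (fun r : ℝ => r * Real.log (max r s)) (Ici 0) := by
  rcases hs.eq_or_lt with rfl | hs
  · refine Real.continuous_mul_log.continuousOn.congr fun r hr => ?_
    simp only [max_eq_left (mem_Ici.1 hr)]
  · refine continuousOn_id.mul (ContinuousOn.log (by fun_prop) fun r _ => ?_)
    exact (hs.trans_le (le_max_right _ _)).ne'

theorem intervalIntegrable_mul_log_max {a b s : ℝ} (ha : 0 ≤ a) (hab : a ≤ b) (hs : 0 ≤ s) :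
    IntervalIntegrable (fun r : ℝ => r * Real.log (max r s)) volume a b := by
  refine ((continuousOn_mul_log_max hs).mono ?_).intervalIntegrable
  rw [uIcc_of_le hab]
  exact fun r hr => ha.trans hr.1

theorem integral_mul_log {a b : ℝ} (ha : 0 ≤ a) (hab : a ≤ b) :
    ∫ r in a..b, r * Real.log r =
      (b ^ 2 * Real.log b / 2 - b ^ 2 / 4) - (a ^ 2 * Real.log a / 2 - a ^ 2 / 4) := by
  refine intervalIntegral.integral_eq_sub_of_hasDerivAt_of_le
    (f := fun r => r ^ 2 * Real.log r / 2 - r ^ 2 / 4) hab ?_ (fun r hr => ?_)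
    (Real.continuous_mul_log.intervalIntegrable _ _)
  · have : (fun r : ℝ => r ^ 2 * Real.log r / 2 - r ^ 2 / 4) =
        fun r => r * (r * Real.log r) / 2 - r ^ 2 / 4 := by ext r; ring
    rw [this]
    have := Real.continuous_mul_log
    exact Continuous.continuousOn (by fun_prop)
  · have hr0 : r ≠ 0 := (ha.trans_lt hr.1).ne'
    have h := ((((hasDerivAt_pow 2 r).mul (Real.hasDerivAt_log hr0)).div_const 2).sub
      ((hasDerivAt_pow 2 r).div_const 4))
    refine h.congr_deriv ?_
    push_cast
    field_simp
    ring

theorem integral_mul_log_max_of_le {a b s : ℝ} (ha : 0 ≤ a) (hab : a ≤ b) (hs : s ≤ a) :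
    ∫ r in a..b, r * Real.log (max r s) =
      (b ^ 2 * Real.log b / 2 - b ^ 2 / 4) - (a ^ 2 * Real.log a / 2 - a ^ 2 / 4) := by
  rw [← integral_mul_log ha hab]
  refine intervalIntegral.integral_congr fun r hr => ?_
  rw [uIcc_of_le hab] at hr
  simp only [max_eq_left (hs.trans hr.1)]

theorem integral_mul_log_max_of_ge {a b s : ℝ} (hab : a ≤ b) (hs : b ≤ s) :
    ∫ r in a..b, r * Real.log (max r s) = (b ^ 2 - a ^ 2) / 2 * Real.log s := by
  rw [← integral_id, ← intervalIntegral.integral_mul_const]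
  refine intervalIntegral.integral_congr fun r hr => ?_
  rw [uIcc_of_le hab] at hr
  simp only [max_eq_right (hr.2.trans hs)]

theorem integral_mul_log_max_of_mem {a b s : ℝ} (ha : 0 ≤ a) (has : a ≤ s) (hsb : s ≤ b) :
    ∫ r in a..b, r * Real.log (max r s) =
      (b ^ 2 * Real.log b / 2 - b ^ 2 / 4) - (a ^ 2 * Real.log s / 2 - s ^ 2 / 4) := by
  have hs := ha.trans has
  rw [← intervalIntegral.integral_add_adjacent_intervals
    (intervalIntegrable_mul_log_max ha has hs) (intervalIntegrable_mul_log_max hs hsb hs),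
    integral_mul_log_max_of_ge has le_rfl, integral_mul_log_max_of_le hs hsb le_rfl]
  ring

/-- Pointwise, r log max(r, s) ≥ r log r ≥ r - 1 ≥ -1. The bound is uniform in s, which later bounds
the potential below on the whole plane. -/
theorem neg_le_integral_mul_log_max {a b s : ℝ} (ha : 0 ≤ a) (hab : a ≤ b) (hs : 0 ≤ s) :
    -(b - a) ≤ ∫ r in a..b, r * Real.log (max r s) := by
  have h : ∫ _ in a..b, (-1 : ℝ) = -(b - a) := by simp
  rw [← h]
  refine intervalIntegral.integral_mono_on hab (by simp) (intervalIntegrable_mul_log_max ha hab hs)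
    fun r hr => ?_
  rcases (ha.trans hr.1).eq_or_lt with h0 | h0
  · rw [← h0]; norm_num
  · have h1 := Real.one_sub_inv_le_log_of_pos h0
    have h2 := Real.log_le_log h0 (le_max_left r s)
    have h3 : r * (1 - r⁻¹) = r - 1 := by field_simp
    nlinarith

/-- Jensen's formula for the circle mean. The starting angle is free because polar coordinates use
(-π, π) and `unitCircleMeasure` uses (0, 2π]. -/
theorem circle_log_norm_sub (z : ℂ) {r : ℝ} (hr : 0 < r) (t : ℝ) :
    IntervalIntegrable (fun θ => Real.log ‖z - circleMap 0 r θ‖) volume t (t + 2 * Real.pi) ∧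
    ∫ θ in t..t + 2 * Real.pi, Real.log ‖z - circleMap 0 r θ‖ =
      2 * Real.pi * Real.log (max r ‖z‖) := by
  have hper : Function.Periodic (fun θ => Real.log ‖z - circleMap 0 r θ‖) (2 * Real.pi) := fun θ => by
    simp only [periodic_circleMap 0 r θ]
  have hint := circleIntegrable_log_norm_sub_const (a := z) (c := 0) r
  have havg := circleAverage_log_norm_sub_const_eq_log_radius_add_posLog (a := z) (c := 0) hr.ne'
  simp only [CircleIntegrable, norm_sub_rev _ z] at hint
  simp only [Real.circleAverage_def, norm_sub_rev _ z, zero_sub, norm_neg] at havg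
  have hpi := Real.pi_pos
  constructor
  · have h0 : IntervalIntegrable (fun θ => Real.log ‖z - circleMap 0 r θ‖) volume 0
      (0 + 2 * Real.pi) := by rwa [zero_add]
    exact hper.intervalIntegrable (by positivity) h0 _ _
  · have h1 := hper.intervalIntegral_add_eq t 0
    rw [zero_add] at h1
    rw [h1]
    rw [smul_eq_mul, inv_mul_eq_iff_eq_mul₀ (by positivity)] at havg
    rw [havg]
    congr 1
    rcases le_total ‖z‖ r with h | h
    · rw [max_eq_left h, (Real.posLog_eq_zero_iff _).2, add_zero]
      rw [abs_of_nonneg (by positivity), inv_mul_le_iff₀ hr]; linarith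
    · have hz : 0 < ‖z‖ := hr.trans_le h
      rw [max_eq_right h, Real.posLog_eq_log, Real.log_mul (by positivity) hz.ne', Real.log_inv]
      · ring
      · rw [abs_of_nonneg (by positivity), le_inv_mul_iff₀ hr]; linarith

/-- The closed annulus `a ≤ |w| ≤ b`. -/
def annulus (a b : ℝ) : Set ℂ := {w | a ≤ ‖w‖ ∧ ‖w‖ ≤ b}

theorem measurableSet_annulus (a b : ℝ) : MeasurableSet (annulus a b) :=
  (measurableSet_le measurable_const measurable_norm).inter
    (measurableSet_le measurable_norm measurable_const)

theorem volume_annulus {a b : ℝ} (ha : 0 ≤ a) (hab : a ≤ b) :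
    volume (annulus a b) = ENNReal.ofReal (Real.pi * (b ^ 2 - a ^ 2)) := by
  have h : annulus a b = Metric.closedBall 0 b \ Metric.ball 0 a := by
    ext w; simp [annulus, and_comm]
  rw [h, measure_sdiff (Metric.ball_subset_closedBall.trans (Metric.closedBall_subset_closedBall hab))
    measurableSet_ball.nullMeasurableSet (by simp [Complex.volume_ball]; finiteness),
    Complex.volume_closedBall, Complex.volume_ball, mul_comm Real.pi,
    ENNReal.ofReal_mul (sub_nonneg.2 (pow_le_pow_left₀ ha hab 2)),
    ENNReal.ofReal_sub _ (by positivity), ENNReal.ofReal_pow (ha.trans hab), ENNReal.ofReal_pow ha,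
    ← NNReal.coe_real_pi, ENNReal.ofReal_coe_nnreal, ENNReal.sub_mul]
  simp

/-- Since log x ≤ x, the constant M dominates log|z - w| on the annulus. The integrand is then
nonnegative, so polar coordinates and Tonelli apply before integrability of the logarithm is known.
-/
theorem lintegral_annulus_sub_log {a b M : ℝ} {z : ℂ} (ha : 0 ≤ a) (hab : a ≤ b)
    (hM : ‖z‖ + b ≤ M) :
    ∫⁻ w in annulus a b, ENNReal.ofReal (M - Real.log ‖z - w‖) =
      ENNReal.ofReal (2 * Real.pi *
        (M * (b ^ 2 - a ^ 2) / 2 - ∫ r in a..b, r * Real.log (max r ‖z‖))) := by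
  have hpi := Real.pi_pos
  have hmeas : Measurable fun w : ℂ => ENNReal.ofReal (M - Real.log ‖z - w‖) := by fun_prop
  have hcirc : ∀ p : ℝ × ℝ, Complex.polarCoord.symm p = circleMap 0 p.1 p.2 := fun p => by
    rw [Complex.polarCoord_symm_apply, circleMap_zero, Complex.exp_mul_I]
    push_cast; rfl
  rw [← lintegral_indicator (measurableSet_annulus a b), ← Complex.lintegral_comp_polarCoord_symm]
  simp only [hcirc]
  have htgt : (polarCoord.target : Set (ℝ × ℝ)) = Ioi (0 : ℝ) ×ˢ Ioo (-Real.pi) Real.pi := rfl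
  rw [htgt, Measure.volume_eq_prod, ← Measure.prod_restrict]
  have hcm : Measurable fun p : ℝ × ℝ => circleMap 0 p.1 p.2 := by
    simp only [circleMap_zero]; fun_prop
  rw [lintegral_prod _ (by
    refine Measurable.aemeasurable ?_
    simp only [smul_eq_mul]
    exact (by fun_prop : Measurable fun p : ℝ × ℝ => ENNReal.ofReal p.1).mul
      ((hmeas.indicator (measurableSet_annulus a b)).comp hcm))]
  have hin : ∀ r ∈ Ioi (0 : ℝ), ∫⁻ θ in Ioo (-Real.pi) Real.pi, ENNReal.ofReal r •
      (annulus a b).indicator (fun w => ENNReal.ofReal (M - Real.log ‖z - w‖)) (circleMap 0 r θ) =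
      (Icc a b).indicator
        (fun r => ENNReal.ofReal (2 * Real.pi * (M * r - r * Real.log (max r ‖z‖)))) r := by
    intro r hr
    have hr0 : 0 < r := hr
    have hmem : ∀ θ, circleMap 0 r θ ∈ annulus a b ↔ r ∈ Icc a b := fun θ => by
      simp [annulus, abs_of_pos hr0]
    by_cases h : r ∈ Icc a b
    · simp only [indicator_of_mem h, indicator_of_mem ((hmem _).2 h), smul_eq_mul]
      have hm : Measurable fun θ => ENNReal.ofReal (M - Real.log ‖z - circleMap 0 r θ‖) :=
        hmeas.comp (hcm.comp measurable_prodMk_left)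
      rw [lintegral_const_mul _ hm]
      obtain ⟨hi, he⟩ := circle_log_norm_sub z hr0 (-Real.pi)
      have e1 : -Real.pi + 2 * Real.pi = Real.pi := by ring
      rw [e1] at hi he
      rw [intervalIntegrable_iff_integrableOn_Ioo_of_le (by linarith)] at hi
      rw [intervalIntegral.integral_of_le (by linarith), integral_Ioc_eq_integral_Ioo] at he
      have hs : IntegrableOn (fun θ => M - Real.log ‖z - circleMap 0 r θ‖)
          (Ioo (-Real.pi) Real.pi) := (integrable_const M).sub hi
      rw [← ofReal_integral_eq_lintegral_ofReal hs, ← ENNReal.ofReal_mul hr0.le,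
        integral_sub (integrable_const M) hi, he]
      · congr 1
        simp [Real.volume_real_Ioo_of_le (show -Real.pi ≤ Real.pi by linarith)]
        ring
      · refine Eventually.of_forall fun θ => ?_
        have h1 := Real.log_le_self (norm_nonneg (z - circleMap 0 r θ))
        have h2 := norm_sub_le z (circleMap 0 r θ)
        have h3 : ‖circleMap 0 r θ‖ = r := by simp [abs_of_pos hr0]
        simp only [Pi.zero_apply]
        linarith [h.2]
    · simp only [indicator_of_notMem h, indicator_of_notMem (fun h' => h ((hmem _).1 h'))]
      simp
  rw [setLIntegral_congr_fun measurableSet_Ioi hin, lintegral_indicator measurableSet_Icc,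
    Measure.restrict_restrict measurableSet_Icc]
  have hset : (Icc a b ∩ Ioi 0 : Set ℝ) =ᵐ[volume] Ioc a b := by
    have h1 : (Ioc a b ∩ Ioi 0 : Set ℝ) = Ioc a b :=
      inter_eq_left.2 fun r hr => ha.trans_lt hr.1
    rw [← h1]
    exact ae_eq_set_inter Ioc_ae_eq_Icc.symm (ae_eq_refl _)
  rw [setLIntegral_congr hset]
  have hi := intervalIntegrable_mul_log_max ha hab (norm_nonneg z)
  have hi2 : IntervalIntegrable (fun r => M * r - r * Real.log (max r ‖z‖)) volume a b :=
    (Continuous.intervalIntegrable (by fun_prop) _ _).sub hi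
  have hi3 := hi2.const_mul (2 * Real.pi)
  rw [← ofReal_integral_eq_lintegral_ofReal hi3.1, ← intervalIntegral.integral_of_le hab,
    intervalIntegral.integral_const_mul, intervalIntegral.integral_sub
    (Continuous.intervalIntegrable (by fun_prop) _ _) hi, intervalIntegral.integral_const_mul,
    integral_id]
  · congr 2; ring
  · filter_upwards [ae_restrict_mem measurableSet_Ioc] with r hr
    have hr0 : 0 < r := ha.trans_lt hr.1
    have h1 := Real.log_le_self (hr0.le.trans (le_max_left r ‖z‖))
    have h2 : max r ‖z‖ ≤ M := max_le (by linarith [hr.2, norm_nonneg z]) (by linarith)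
    have : 0 ≤ r * (M - Real.log (max r ‖z‖)) := mul_nonneg hr0.le (by linarith)
    simp only [Pi.zero_apply]
    rw [← mul_comm r M, ← mul_sub]
    positivity

/-- The logarithmic potential of an annulus. -/
theorem integral_annulus_log {a b : ℝ} (z : ℂ) (ha : 0 ≤ a) (hab : a ≤ b) :
    IntegrableOn (fun w => Real.log ‖z - w‖) (annulus a b) ∧
    ∫ w in annulus a b, Real.log ‖z - w‖ =
      2 * Real.pi * ∫ r in a..b, r * Real.log (max r ‖z‖) := by
  set M := ‖z‖ + b with hM
  have hpi := Real.pi_pos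
  have hl := lintegral_annulus_sub_log ha hab hM.symm.le
  have hnn : 0 ≤ᵐ[volume.restrict (annulus a b)] fun w => M - Real.log ‖z - w‖ := by
    filter_upwards [ae_restrict_mem (measurableSet_annulus a b)] with w hw
    have h1 := Real.log_le_self (norm_nonneg (z - w))
    have h2 := norm_sub_le z w
    have h3 := hw.2
    simp only [Pi.zero_apply]
    linarith
  have hmeas : Measurable fun w : ℂ => M - Real.log ‖z - w‖ := by fun_prop
  have hi : IntegrableOn (fun w => M - Real.log ‖z - w‖) (annulus a b) := by
    refine ⟨hmeas.aestronglyMeasurable, ?_⟩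
    rw [hasFiniteIntegral_iff_ofReal hnn, hl]
    exact ENNReal.ofReal_lt_top
  have hc : IntegrableOn (fun _ : ℂ => M) (annulus a b) := by
    refine integrableOn_const ?_
    rw [volume_annulus ha hab]; exact ENNReal.ofReal_ne_top
  have hlog : (fun w => Real.log ‖z - w‖) = fun w => M - (M - Real.log ‖z - w‖) := by ext w; ring
  constructor
  · rw [hlog]; exact hc.sub hi
  · rw [hlog, integral_sub hc hi, integral_eq_lintegral_of_nonneg_ae hnn hmeas.aestronglyMeasurable, hl,
      setIntegral_const, measureReal_def, volume_annulus ha hab, ENNReal.toReal_ofReal,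
      ENNReal.toReal_ofReal]
    · simp only [smul_eq_mul]; ring
    -- This gives nonnegativity of the argument of `ENNReal.ofReal`, so that `toReal` recovers it
    -- without truncation.
    · have hJ : ∫ r in a..b, r * Real.log (max r ‖z‖) ≤ ∫ r in a..b, M * r := by
        refine intervalIntegral.integral_mono_on hab
          (intervalIntegrable_mul_log_max ha hab (norm_nonneg z))
          (Continuous.intervalIntegrable (by fun_prop) _ _) fun r hr => ?_
        have hr0 : 0 ≤ r := ha.trans hr.1
        have h1 := Real.log_le_self (hr0.trans (le_max_left r ‖z‖))
        have h2 : max r ‖z‖ ≤ M := max_le (by linarith [hr.2, norm_nonneg z]) (by linarith)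
        rw [mul_comm M]
        exact mul_le_mul_of_nonneg_left (h1.trans h2) hr0
      rw [intervalIntegral.integral_const_mul, integral_id] at hJ
      refine mul_nonneg (by positivity) ?_
      linarith
    · have : a ^ 2 ≤ b ^ 2 := pow_le_pow_left₀ ha hab 2
      exact mul_nonneg hpi.le (by linarith)

end Potential

/-! ### The candidate measure and its explicit potential. -/

section DeficiencyMeasure

open Filter Topology Set

variable {p α : ℝ}

instance isProbabilityMeasure_unitCircleMeasure : IsProbabilityMeasure unitCircleMeasure := by
  have hpi := Real.pi_pos
  refine ⟨?_⟩
  rw [unitCircleMeasure, Measure.map_apply (continuous_circleMap 0 1).measurable MeasurableSet.univ]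
  simp only [preimage_univ, Measure.smul_apply, Measure.restrict_apply MeasurableSet.univ, univ_inter,
    Real.volume_Ioc, sub_zero, smul_eq_mul]
  exact ENNReal.inv_mul_cancel (by simpa using hpi) ENNReal.ofReal_ne_top

theorem unitCircleMeasure_ae_norm_eq_one : ∀ᵐ z ∂unitCircleMeasure, ‖z‖ = 1 := by
  rw [unitCircleMeasure, ae_map_iff (continuous_circleMap 0 1).aemeasurable
    (measurableSet_eq_fun measurable_norm measurable_const)]
  exact Eventually.of_forall fun θ => by simp

theorem unitCircleMeasure_singleton (z : ℂ) : unitCircleMeasure {z} = 0 := by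
  rw [unitCircleMeasure, Measure.map_apply (continuous_circleMap 0 1).measurable
    (measurableSet_singleton z), Measure.smul_apply]
  have h : (volume.restrict (Ioc (0 : ℝ) (2 * Real.pi))) (circleMap 0 1 ⁻¹' {z}) = 0 :=
    ((countable_singleton z).preimage_circleMap 0 one_ne_zero).measure_zero _
  rw [h, smul_zero]

theorem integral_unitCircleMeasure_log (z : ℂ) :
    Integrable (fun w => Real.log ‖z - w‖) unitCircleMeasure ∧
    ∫ w, Real.log ‖z - w‖ ∂unitCircleMeasure = Real.log (max 1 ‖z‖) := by
  have hpi := Real.pi_pos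
  obtain ⟨h1, h2⟩ := circle_log_norm_sub z one_pos 0
  rw [zero_add] at h1 h2
  rw [intervalIntegral.integral_of_le (by positivity)] at h2
  have hm : Measurable fun w : ℂ => Real.log ‖z - w‖ := by fun_prop
  have hc := (continuous_circleMap 0 1).aemeasurable
    (μ := (ENNReal.ofReal (2 * Real.pi))⁻¹ • (volume.restrict (Ioc (0 : ℝ) (2 * Real.pi))))
  have hne : ENNReal.ofReal (2 * Real.pi) ≠ 0 := by simpa using hpi
  constructor
  · rw [unitCircleMeasure, integrable_map_measure hm.aestronglyMeasurable hc]
    exact h1.1.smul_measure (ENNReal.inv_ne_top.2 hne)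
  · rw [unitCircleMeasure, integral_map hc hm.aestronglyMeasurable, integral_smul_measure, h2,
      ENNReal.toReal_inv, ENNReal.toReal_ofReal (by positivity), smul_eq_mul]
    field_simp

theorem normalizedDeficiencyMeasure_eq (p α : ℝ) : normalizedDeficiencyMeasure p α =
    (ENNReal.ofReal α)⁻¹ • ((ENNReal.ofReal Real.pi)⁻¹ •
      (volume.restrict (annulus 0 √p) + volume.restrict (annulus 1 √α)) +
      ENNReal.ofReal (1 - p) • unitCircleMeasure) := by
  have : annulus 0 √p = {z : ℂ | ‖z‖ ≤ √p} := by ext z; simp [annulus]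
  rw [this]; rfl

theorem integral_normalizedDeficiencyMeasure (hp1 : p < 1) (hα : 1 ≤ α) {f : ℂ → ℝ}
    (h1 : IntegrableOn f (annulus 0 √p)) (h2 : IntegrableOn f (annulus 1 √α))
    (h3 : Integrable f unitCircleMeasure) :
    Integrable f (normalizedDeficiencyMeasure p α) ∧
    ∫ z, f z ∂(normalizedDeficiencyMeasure p α) =
      α⁻¹ * (Real.pi⁻¹ * ((∫ z in annulus 0 √p, f z) + ∫ z in annulus 1 √α, f z) +
        (1 - p) * ∫ z, f z ∂unitCircleMeasure) := by
  have hpi := Real.pi_pos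
  have hα0 : 0 < α := by linarith
  rw [normalizedDeficiencyMeasure_eq]
  have i0 : Integrable f (volume.restrict (annulus 0 √p) + volume.restrict (annulus 1 √α)) :=
    Integrable.add_measure h1 h2
  have i1 := i0.smul_measure
    (c := (ENNReal.ofReal Real.pi)⁻¹) (ENNReal.inv_ne_top.2 (by simpa using hpi))
  have i2 := h3.smul_measure (c := ENNReal.ofReal (1 - p)) ENNReal.ofReal_ne_top
  constructor
  · exact (i1.add_measure i2).smul_measure (ENNReal.inv_ne_top.2 (by simpa using hα0))
  · rw [integral_smul_measure, integral_add_measure i1 i2, integral_smul_measure,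
      integral_smul_measure, integral_add_measure h1 h2, ENNReal.toReal_inv, ENNReal.toReal_inv,
      ENNReal.toReal_ofReal hpi.le, ENNReal.toReal_ofReal hα0.le,
      ENNReal.toReal_ofReal (by linarith)]
    simp only [smul_eq_mul]

theorem normalizedDeficiencyMeasure_ae_of {Q : ℂ → Prop}
    (hQ : ∀ᵐ z ∂(volume.restrict (annulus 0 √p)), Q z)
    (hQ2 : ∀ᵐ z ∂(volume.restrict (annulus 1 √α)), Q z) (hQ3 : ∀ᵐ z ∂unitCircleMeasure, Q z) :
    ∀ᵐ z ∂(normalizedDeficiencyMeasure p α), Q z := by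
  rw [normalizedDeficiencyMeasure_eq]
  refine Measure.ae_smul_measure ?_ _
  rw [ae_add_measure_iff]
  exact ⟨Measure.ae_smul_measure (ae_add_measure_iff.2 ⟨hQ, hQ2⟩) _, Measure.ae_smul_measure hQ3 _⟩

theorem normalizedDeficiencyMeasure_ae_mem (hα : 1 ≤ α) :
    ∀ᵐ z ∂(normalizedDeficiencyMeasure p α), ‖z‖ ≤ √p ∨ (1 ≤ ‖z‖ ∧ ‖z‖ ≤ √α) := by
  refine normalizedDeficiencyMeasure_ae_of ?_ ?_ ?_
  · exact (ae_restrict_mem (measurableSet_annulus _ _)).mono fun z hz => Or.inl hz.2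
  · exact (ae_restrict_mem (measurableSet_annulus _ _)).mono fun z hz => Or.inr hz
  · refine unitCircleMeasure_ae_norm_eq_one.mono fun z hz => Or.inr ⟨hz.ge, ?_⟩
    rw [hz]; exact Real.one_le_sqrt.2 hα

theorem normalizedDeficiencyMeasure_ae_ne (z : ℂ) :
    ∀ᵐ w ∂(normalizedDeficiencyMeasure p α), z ≠ w := by
  have h : ∀ μ : Measure ℂ, μ {z} = 0 → ∀ᵐ w ∂μ, z ≠ w := fun μ hμ => by
    rw [ae_iff]
    have : {w | ¬ z ≠ w} = {z} := by ext w; simp [eq_comm]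
    rwa [this]
  exact normalizedDeficiencyMeasure_ae_of (h _ (by simp)) (h _ (by simp))
    (h _ (unitCircleMeasure_singleton z))

/-- The constraint is active: √p < 1, so the inner disk lies in D, while the outer annulus misses D
and the circle measure gives it no mass. -/
theorem normalizedDeficiencyMeasure_apply (hp0 : 0 ≤ p) (hp1 : p < 1) (hα : 1 ≤ α) :
    normalizedDeficiencyMeasure p α univ = 1 ∧
    normalizedDeficiencyMeasure p α {z : ℂ | ‖z‖ < 1} = ENNReal.ofReal (p / α) := by
  have hpi := Real.pi_pos
  have hα0 : 0 < α := by linarith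
  have hsp : √p < 1 := by rw [Real.sqrt_lt' one_pos]; linarith
  have hv0 : volume (annulus 0 √p) = ENNReal.ofReal (Real.pi * p) := by
    rw [volume_annulus le_rfl (Real.sqrt_nonneg p), Real.sq_sqrt hp0]; simp
  have hv1 : volume (annulus 1 √α) = ENNReal.ofReal (Real.pi * (α - 1)) := by
    rw [volume_annulus zero_le_one (Real.one_le_sqrt.2 hα), Real.sq_sqrt hα0.le]; simp
  have hD : MeasurableSet {z : ℂ | ‖z‖ < 1} := measurableSet_lt measurable_norm measurable_const
  rw [normalizedDeficiencyMeasure_eq, ← ENNReal.ofReal_inv_of_pos hα0, ← ENNReal.ofReal_inv_of_pos hpi]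
  simp only [Measure.smul_apply, Measure.add_apply, smul_eq_mul, Measure.restrict_apply hD,
    Measure.restrict_apply MeasurableSet.univ, univ_inter, measure_univ, mul_one, hv0, hv1]
  have e1 : {z : ℂ | ‖z‖ < 1} ∩ annulus 0 √p = annulus 0 √p :=
    inter_eq_right.2 fun z hz => hz.2.trans_lt hsp
  have e2 : {z : ℂ | ‖z‖ < 1} ∩ annulus 1 √α = ∅ := by
    ext z
    simp only [annulus, mem_inter_iff, mem_ofPred_eq, mem_empty_iff_false, iff_false]
    intro h; linarith [h.1, h.2.1]
  have e3 : unitCircleMeasure {z : ℂ | ‖z‖ < 1} = 0 :=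
    measure_mono_null (fun z hz => (show ¬ ‖z‖ = 1 from (hz : ‖z‖ < 1).ne))
      (ae_iff.1 unitCircleMeasure_ae_norm_eq_one)
  constructor
  · rw [← ENNReal.ofReal_add (by positivity) (mul_nonneg hpi.le (by linarith)),
      ← ENNReal.ofReal_mul (by positivity), ← ENNReal.ofReal_add, ← ENNReal.ofReal_mul (by positivity),
      ← ENNReal.ofReal_one]
    · congr 1; field_simp; ring
    · have : 0 ≤ Real.pi * (α - 1) := mul_nonneg hpi.le (by linarith)
      positivity
    · linarith
  · rw [e1, e2, e3, hv0, measure_empty, mul_zero, add_zero, add_zero, ← ENNReal.ofReal_mul (by positivity),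
      ← ENNReal.ofReal_mul (by positivity)]
    congr 1; field_simp

/-- The logarithmic potential of the normalized deficiency measure, as a real number. -/
noncomputable def deficiencyPotential (p α : ℝ) (z : ℂ) : ℝ :=
  α⁻¹ * (2 * ((∫ r in (0 : ℝ)..√p, r * Real.log (max r ‖z‖)) +
    ∫ r in (1 : ℝ)..√α, r * Real.log (max r ‖z‖)) + (1 - p) * Real.log (max 1 ‖z‖))

theorem integral_normalizedDeficiencyMeasure_log (hp1 : p < 1) (hα : 1 ≤ α) (z : ℂ) :
    Integrable (fun w => Real.log ‖z - w‖) (normalizedDeficiencyMeasure p α) ∧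
    ∫ w, Real.log ‖z - w‖ ∂(normalizedDeficiencyMeasure p α) = deficiencyPotential p α z := by
  have hpi := Real.pi_pos
  obtain ⟨a1, a2⟩ := integral_annulus_log z le_rfl (Real.sqrt_nonneg p)
  obtain ⟨b1, b2⟩ := integral_annulus_log z zero_le_one (Real.one_le_sqrt.2 hα)
  obtain ⟨c1, c2⟩ := integral_unitCircleMeasure_log z
  obtain ⟨h1, h2⟩ := integral_normalizedDeficiencyMeasure hp1 hα a1 b1 c1
  refine ⟨h1, ?_⟩
  rw [h2, a2, b2, c2, deficiencyPotential]
  field_simp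

theorem deficiencyPotential_lower (hp1 : p < 1) (hα : 1 ≤ α) (z : ℂ) :
    -(α⁻¹ * (2 * (√p + (√α - 1)))) ≤ deficiencyPotential p α z := by
  have h1 := neg_le_integral_mul_log_max le_rfl (Real.sqrt_nonneg p) (norm_nonneg z)
  have h2 := neg_le_integral_mul_log_max zero_le_one (Real.one_le_sqrt.2 hα) (norm_nonneg z)
  have h3 : 0 ≤ (1 - p) * Real.log (max 1 ‖z‖) :=
    mul_nonneg (by linarith) (Real.log_nonneg (le_max_left _ _))
  have hα0 : 0 < α⁻¹ := by positivity
  rw [deficiencyPotential, ← mul_neg]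
  exact mul_le_mul_of_nonneg_left (by linarith) hα0.le

/-- For p > 0, apply log x < x - 1 at x = 1/p and multiply by p. -/
theorem potentialGap_pos (hp0 : 0 ≤ p) (hp1 : p < 1) (hα : 1 ≤ α) : 0 < potentialGap p α := by
  have hα0 : 0 < α := by linarith
  refine div_pos ?_ (by positivity)
  rcases hp0.eq_or_lt with rfl | hp
  · norm_num
  · have h := Real.log_lt_sub_one_of_pos (inv_pos.2 hp) (by
      rw [ne_eq, inv_eq_one]; exact hp1.ne)
    rw [Real.log_inv] at h
    have h2 : p * (p⁻¹ - 1) = 1 - p := by field_simp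
    nlinarith

theorem deficiencyPotential_of_le_sqrt (hp0 : 0 ≤ p) (hp1 : p < 1) (hα : 1 ≤ α) {z : ℂ}
    (hz : ‖z‖ ≤ √p) : deficiencyPotential p α z =
      ‖z‖ ^ 2 / (2 * α) + (Real.log α - 1) / 2 + potentialGap p α := by
  have hα0 : 0 < α := by linarith
  have hsp : √p < 1 := by rw [Real.sqrt_lt' one_pos]; linarith
  have hz1 : ‖z‖ ≤ 1 := by linarith
  rw [deficiencyPotential, integral_mul_log_max_of_mem le_rfl (norm_nonneg z) hz,
    integral_mul_log_max_of_le zero_le_one (Real.one_le_sqrt.2 hα) hz1, max_eq_left hz1,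
    Real.sq_sqrt hp0, Real.sq_sqrt hα0.le, Real.log_sqrt hp0, Real.log_sqrt hα0.le, potentialGap,
    Real.log_one]
  field_simp
  ring

theorem deficiencyPotential_of_mem_annulus (hp0 : 0 ≤ p) (hp1 : p < 1) (hα : 1 ≤ α) {z : ℂ}
    (hz : 1 ≤ ‖z‖) (hz2 : ‖z‖ ≤ √α) : deficiencyPotential p α z =
      ‖z‖ ^ 2 / (2 * α) + (Real.log α - 1) / 2 := by
  have hα0 : 0 < α := by linarith
  have hsp : √p < 1 := by rw [Real.sqrt_lt' one_pos]; linarith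
  rw [deficiencyPotential, integral_mul_log_max_of_ge (Real.sqrt_nonneg p) (hsp.le.trans hz),
    integral_mul_log_max_of_mem zero_le_one hz hz2, max_eq_right hz,
    Real.sq_sqrt hp0, Real.sq_sqrt hα0.le, Real.log_sqrt hα0.le]
  field_simp
  ring

theorem deficiencyPotential_lt_of_gap (hp0 : 0 ≤ p) (hα : 1 ≤ α) {z : ℂ}
    (hz : √p < ‖z‖) (hz2 : ‖z‖ < 1) : deficiencyPotential p α z <
      ‖z‖ ^ 2 / (2 * α) + (Real.log α - 1) / 2 + potentialGap p α := by
  have hα0 : 0 < α := by linarith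
  have hz0 : 0 < ‖z‖ := (Real.sqrt_nonneg p).trans_lt hz
  have hpz : p < ‖z‖ ^ 2 := (Real.sqrt_lt' hz0).1 hz
  -- For p > 0 this is p log x < p(x - 1) with x = |z|²/p > 1.
  have key : p * (2 * Real.log ‖z‖) < ‖z‖ ^ 2 + p * Real.log p - p := by
    rcases hp0.eq_or_lt with rfl | hp
    · simp; positivity
    · have h := Real.log_lt_sub_one_of_pos (div_pos (pow_pos hz0 2) hp)
        (by rw [ne_eq, div_eq_one_iff_eq hp.ne']; exact hpz.ne')
      rw [Real.log_div (by positivity) hp.ne', Real.log_pow] at h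
      have h2 : p * (‖z‖ ^ 2 / p - 1) = ‖z‖ ^ 2 - p := by field_simp
      push_cast at h
      nlinarith
  rw [deficiencyPotential, integral_mul_log_max_of_ge (Real.sqrt_nonneg p) hz.le,
    integral_mul_log_max_of_le zero_le_one (Real.one_le_sqrt.2 hα) hz2.le, max_eq_left hz2.le,
    Real.sq_sqrt hp0, Real.sq_sqrt hα0.le, Real.log_sqrt hα0.le, potentialGap, Real.log_one]
  have e : ‖z‖ ^ 2 / (2 * α) + (Real.log α - 1) / 2 + (p * (Real.log p - 1) + 1) / (2 * α) =
      α⁻¹ * (‖z‖ ^ 2 / 2 + α * (Real.log α - 1) / 2 + (p * (Real.log p - 1) + 1) / 2) := by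
    field_simp
  rw [e]
  refine mul_lt_mul_of_pos_left ?_ (inv_pos.2 hα0)
  linarith

theorem deficiencyPotential_lt_of_sqrt_lt (hp0 : 0 ≤ p) (hp1 : p < 1) (hα : 1 ≤ α) {z : ℂ}
    (hz : √α < ‖z‖) : deficiencyPotential p α z <
      ‖z‖ ^ 2 / (2 * α) + (Real.log α - 1) / 2 := by
  have hα0 : 0 < α := by linarith
  have hsp : √p < 1 := by rw [Real.sqrt_lt' one_pos]; linarith
  have hz1 : 1 < ‖z‖ := (Real.one_le_sqrt.2 hα).trans_lt hz
  have hz0 : 0 < ‖z‖ := by linarith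
  have hpz : α < ‖z‖ ^ 2 := (Real.sqrt_lt' hz0).1 hz
  have h := Real.log_lt_sub_one_of_pos (div_pos (pow_pos hz0 2) hα0)
    (by rw [ne_eq, div_eq_one_iff_eq hα0.ne']; exact hpz.ne')
  rw [Real.log_div (by positivity) hα0.ne', Real.log_pow] at h
  push_cast at h
  rw [deficiencyPotential, integral_mul_log_max_of_ge (Real.sqrt_nonneg p) (by linarith),
    integral_mul_log_max_of_ge (Real.one_le_sqrt.2 hα) hz.le, max_eq_right hz1.le,
    Real.sq_sqrt hp0, Real.sq_sqrt hα0.le]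
  -- Outside the support the radial unit mass acts as if placed at the origin, so the potential is
  -- log|z|. The claim becomes log x < x - 1 at x = |z|²/α.
  have e1 : α⁻¹ * (2 * ((p - 0 ^ 2) / 2 * Real.log ‖z‖ + (α - 1 ^ 2) / 2 * Real.log ‖z‖) +
      (1 - p) * Real.log ‖z‖) = Real.log ‖z‖ := by
    field_simp; ring
  have e2 : ‖z‖ ^ 2 / (2 * α) = ‖z‖ ^ 2 / α / 2 := by field_simp
  rw [e1, e2]
  linarith

theorem deficiencyPotential_le (hp0 : 0 ≤ p) (hp1 : p < 1) (hα : 1 ≤ α) (z : ℂ) :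
    deficiencyPotential p α z ≤ ‖z‖ ^ 2 / (2 * α) + (Real.log α - 1) / 2 +
      {z : ℂ | ‖z‖ < 1}.indicator (fun _ => potentialGap p α) z := by
  by_cases h : ‖z‖ < 1
  · rw [indicator_of_mem (show z ∈ {z : ℂ | ‖z‖ < 1} from h)]
    rcases le_or_gt ‖z‖ √p with h2 | h2
    · exact (deficiencyPotential_of_le_sqrt hp0 hp1 hα h2).le
    · exact (deficiencyPotential_lt_of_gap hp0 hα h2 h).le
  · rw [indicator_of_notMem (show z ∉ {z : ℂ | ‖z‖ < 1} from h), add_zero]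
    rcases le_or_gt ‖z‖ √α with h2 | h2
    · exact (deficiencyPotential_of_mem_annulus hp0 hp1 hα (not_lt.1 h) h2).le
    · exact (deficiencyPotential_lt_of_sqrt_lt hp0 hp1 hα h2).le

theorem deficiencyPotential_ae_eq (hp0 : 0 ≤ p) (hp1 : p < 1) (hα : 1 ≤ α) :
    ∀ᵐ z ∂(normalizedDeficiencyMeasure p α),
      deficiencyPotential p α z = ‖z‖ ^ 2 / (2 * α) + (Real.log α - 1) / 2 +
        {z : ℂ | ‖z‖ < 1}.indicator (fun _ => potentialGap p α) z := by
  have hsp : √p < 1 := by rw [Real.sqrt_lt' one_pos]; linarith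
  filter_upwards [normalizedDeficiencyMeasure_ae_mem hα] with z hz
  rcases hz with h | h
  · rw [indicator_of_mem (show z ∈ {z : ℂ | ‖z‖ < 1} from h.trans_lt hsp)]
    exact deficiencyPotential_of_le_sqrt hp0 hp1 hα h
  · rw [indicator_of_notMem (show z ∉ {z : ℂ | ‖z‖ < 1} from not_lt.2 h.1), add_zero]
    exact deficiencyPotential_of_mem_annulus hp0 hp1 hα h.1 h.2

end DeficiencyMeasure

/-! ### From extended-real energies to Bochner integrals. -/

section ExtendedEnergy

open Filter Set

theorem eintegral_eq_coe {X : Type*} [MeasurableSpace X] {μ : Measure X} {F : X → EReal} {f : X → ℝ}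
    (hf : Integrable f μ) (h : ∀ᵐ x ∂μ, F x = (f x : EReal)) :
    eintegral μ F = ((∫ x, f x ∂μ : ℝ) : EReal) := by
  have h1 : ∫⁻ x, (F x).toENNReal ∂μ = ∫⁻ x, ENNReal.ofReal (f x) ∂μ :=
    lintegral_congr_ae (h.mono fun x hx => by simp only [hx, EReal.real_coe_toENNReal])
  have h2 : ∫⁻ x, (-F x).toENNReal ∂μ = ∫⁻ x, ENNReal.ofReal (-f x) ∂μ :=
    lintegral_congr_ae (h.mono fun x hx => by
      simp only [hx, ← EReal.coe_neg, EReal.real_coe_toENNReal])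
  rw [eintegral, h1, h2, integral_eq_lintegral_pos_part_sub_lintegral_neg_part hf, EReal.coe_sub,
    EReal.coe_ennreal_toReal, EReal.coe_ennreal_toReal]
  · exact hf.neg.lintegral_lt_top.ne
  · exact hf.lintegral_lt_top.ne

theorem logKernel_of_ne {z w : ℂ} (h : z ≠ w) : logKernel z w = (Real.log ‖z - w‖ : EReal) := by
  rw [logKernel, ← ofReal_norm, ENNReal.log_ofReal_of_pos (norm_pos_iff.2 (sub_ne_zero.2 h))]

theorem logKernel_self (z : ℂ) : logKernel z z = ⊥ := by simp [logKernel]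

theorem integrable_norm_of_sq {ν : Measure ℂ} [IsProbabilityMeasure ν]
    (h : Integrable (fun z => ‖z‖ ^ 2) ν) : Integrable (fun z : ℂ => ‖z‖) ν := by
  refine ((integrable_const 1).add h).mono' (by fun_prop) (Eventually.of_forall fun z => ?_)
  rw [Real.norm_of_nonneg (norm_nonneg z)]
  simp only [Pi.add_apply]
  nlinarith [sq_nonneg (‖z‖ - 1)]

theorem integrable_sq_of_lintegral {ν : Measure ℂ} {α : ℝ} (hα : 0 < α)
    (h : ∫⁻ z, ENNReal.ofReal (‖z‖ ^ 2 / α) ∂ν ≠ ⊤) : Integrable (fun z => ‖z‖ ^ 2) ν := by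
  have h1 : Integrable (fun z : ℂ => ‖z‖ ^ 2 / α) ν := by
    refine ⟨Continuous.aestronglyMeasurable (by fun_prop), ?_⟩
    rw [hasFiniteIntegral_iff_ofReal (Eventually.of_forall fun z => by positivity)]
    exact lt_top_iff_ne_top.2 h
  refine (h1.mul_const α).congr (Eventually.of_forall fun z => ?_)
  field_simp

/-- Either the logarithmic energy of `ν` is `-∞`, or the logarithm is integrable. -/
theorem logEnergy_eq_bot_or {ν : Measure ℂ} [IsProbabilityMeasure ν]
    (h : Integrable (fun z : ℂ => ‖z‖) ν) :
    logEnergy ν = ⊥ ∨ ((∀ᵐ x ∂(ν.prod ν), x.1 ≠ x.2) ∧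
      Integrable (fun x => Real.log ‖x.1 - x.2‖) (ν.prod ν)) := by
  have hK : Measurable fun x : ℂ × ℂ => (-logKernel x.1 x.2).toENNReal := by
    have h0 : Measurable fun x : ℂ × ℂ => logKernel x.1 x.2 :=
      ENNReal.measurable_log.comp (by fun_prop)
    exact (continuous_neg.measurable.comp h0).ereal_toENNReal
  by_cases hN : ∫⁻ x, (-logKernel x.1 x.2).toENNReal ∂(ν.prod ν) = ⊤
  -- In `EReal` subtracting ⊤ always gives ⊥, even from ⊤, so the positive part needs no estimate
  -- here.
  · left
    rw [logEnergy, eintegral, hN, EReal.coe_ennreal_top, EReal.sub_top]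
  · right
    -- The negative part of the kernel is ⊤ on the diagonal, and its finite integral forces the
    -- diagonal to be null.
    have hne : ∀ᵐ x ∂(ν.prod ν), x.1 ≠ x.2 := by
      filter_upwards [ae_lt_top hK hN] with x hx hxe
      rw [hxe, logKernel_self] at hx
      simp at hx
    refine ⟨hne, ?_⟩
    have hsum : Integrable (fun x : ℂ × ℂ => ‖x.1‖ + ‖x.2‖) (ν.prod ν) :=
      (h.comp_fst ν).add (h.comp_snd ν)
    have hneg : Integrable (fun x : ℂ × ℂ => max (-Real.log ‖x.1 - x.2‖) 0) (ν.prod ν) := by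
      refine ⟨Measurable.aestronglyMeasurable (by fun_prop), ?_⟩
      have hnn : ∀ x : ℂ × ℂ, 0 ≤ max (-Real.log ‖x.1 - x.2‖) 0 := fun x => le_max_right _ _
      rw [hasFiniteIntegral_iff_ofReal (Eventually.of_forall hnn)]
      refine lt_of_le_of_lt (le_of_eq (lintegral_congr_ae ?_)) (lt_top_iff_ne_top.2 hN)
      filter_upwards [hne] with x hx
      rw [logKernel_of_ne hx, ← EReal.coe_neg, EReal.real_coe_toENNReal]
      rcases le_total (-Real.log ‖x.1 - x.2‖) 0 with h0 | h0
      · rw [max_eq_right h0, ENNReal.ofReal_of_nonpos h0, ENNReal.ofReal_zero]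
      · rw [max_eq_left h0]
    refine (hsum.add hneg).mono' (Measurable.aestronglyMeasurable (by fun_prop))
      (Eventually.of_forall fun x => ?_)
    have h1 := Real.log_le_self (norm_nonneg (x.1 - x.2))
    have h2 := norm_sub_le x.1 x.2
    have h3 := le_max_left (-Real.log ‖x.1 - x.2‖) 0
    have h4 := le_max_right (-Real.log ‖x.1 - x.2‖) 0
    simp only [Pi.add_apply, Real.norm_eq_abs]
    rw [abs_le]
    constructor <;> linarith [norm_nonneg x.1, norm_nonneg x.2]

theorem weightedEnergy_eq_coe {ν : Measure ℂ} {α : ℝ} (hα : 0 < α)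
    (h : Integrable (fun z => ‖z‖ ^ 2) ν) (hne : ∀ᵐ x ∂(ν.prod ν), x.1 ≠ x.2)
    (hlog : Integrable (fun x => Real.log ‖x.1 - x.2‖) (ν.prod ν)) :
    weightedEnergy α ν = (((∫ z, ‖z‖ ^ 2 ∂ν) / α - ∫ x, Real.log ‖x.1 - x.2‖ ∂(ν.prod ν) : ℝ) :
      EReal) := by
  have h1 : ∫⁻ z, ENNReal.ofReal (‖z‖ ^ 2 / α) ∂ν = ENNReal.ofReal ((∫ z, ‖z‖ ^ 2 ∂ν) / α) := by
    rw [← ofReal_integral_eq_lintegral_ofReal (h.div_const α)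
      (Eventually.of_forall fun z => by positivity), integral_div]
  have h0 : 0 ≤ (∫ z, ‖z‖ ^ 2 ∂ν) / α :=
    div_nonneg (integral_nonneg fun z => by positivity) hα.le
  rw [weightedEnergy, h1, if_neg ENNReal.ofReal_ne_top, logEnergy,
    eintegral_eq_coe hlog (hne.mono fun x hx => logKernel_of_ne hx), EReal.coe_ennreal_ofReal,
    max_eq_left h0, EReal.coe_sub]

theorem weightedEnergy_eq_top_or {ν : Measure ℂ} [IsProbabilityMeasure ν] {α : ℝ} (hα : 0 < α) :
    weightedEnergy α ν = ⊤ ∨ (Integrable (fun z => ‖z‖ ^ 2) ν ∧ (∀ᵐ x ∂(ν.prod ν), x.1 ≠ x.2) ∧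
      Integrable (fun x => Real.log ‖x.1 - x.2‖) (ν.prod ν)) := by
  by_cases h : ∫⁻ z, ENNReal.ofReal (‖z‖ ^ 2 / α) ∂ν = ⊤
  · left; rw [weightedEnergy, if_pos h]
  · have hs := integrable_sq_of_lintegral hα h
    rcases logEnergy_eq_bot_or (integrable_norm_of_sq hs) with hb | hb
    · left
      rw [weightedEnergy, if_neg h, hb]
      lift ∫⁻ z, ENNReal.ofReal (‖z‖ ^ 2 / α) ∂ν to NNReal using h with q
      exact EReal.coe_sub_bot q
    · exact Or.inr ⟨hs, hb⟩

/-- Since log|z - w| ≤ |z| + |w|, one has |log|z - w|| ≤ 2(|z| + |w|) - log|z - w|. Integrating in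
w, the lower bound on the potential leaves a function of z with linear growth. -/
theorem integrable_log_prod {ν μ : Measure ℂ} [IsProbabilityMeasure ν] [IsProbabilityMeasure μ]
    (hν : Integrable (fun z : ℂ => ‖z‖) ν) (hμ : Integrable (fun z : ℂ => ‖z‖) μ)
    (hlog : ∀ z, Integrable (fun w => Real.log ‖z - w‖) μ) {K : ℝ}
    (hK : ∀ z, -K ≤ ∫ w, Real.log ‖z - w‖ ∂μ) :
    Integrable (fun x => Real.log ‖x.1 - x.2‖) (ν.prod μ) := by
  have hm : AEStronglyMeasurable (fun x : ℂ × ℂ => Real.log ‖x.1 - x.2‖) (ν.prod μ) :=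
    Measurable.aestronglyMeasurable (by fun_prop)
  rw [integrable_prod_iff hm]
  refine ⟨Eventually.of_forall hlog, ?_⟩
  have hb : Integrable (fun z : ℂ => 2 * (‖z‖ + ∫ w, ‖w‖ ∂μ) + K) ν :=
    ((hν.add (integrable_const _)).const_mul 2).add (integrable_const _)
  refine hb.mono' hm.norm.integral_prod_right' (Eventually.of_forall fun z => ?_)
  rw [Real.norm_of_nonneg (integral_nonneg fun w => norm_nonneg _)]
  have hi1 : Integrable (fun w => 2 * (‖z‖ + ‖w‖)) μ := ((integrable_const _).add hμ).const_mul 2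
  have hle : ∫ w, ‖Real.log ‖z - w‖‖ ∂μ ≤ ∫ w, (2 * (‖z‖ + ‖w‖) - Real.log ‖z - w‖) ∂μ := by
    refine integral_mono (hlog z).norm (hi1.sub (hlog z)) fun w => ?_
    have h1 := Real.log_le_self (norm_nonneg (z - w))
    have h2 := norm_sub_le z w
    simp only [Real.norm_eq_abs]
    rw [abs_le]
    constructor <;> linarith [norm_nonneg (z - w)]
  rw [integral_sub hi1 (hlog z), integral_const_mul, integral_add (integrable_const _) hμ,
    integral_const] at hle
  simp only [probReal_univ, one_smul] at hle
  linarith [hK z]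

end ExtendedEnergy

/-! ### Comparison of energies and uniqueness. -/

section Minimizer

open Filter Set

variable {p α : ℝ}

theorem isProbabilityMeasure_normalizedDeficiencyMeasure (hp0 : 0 ≤ p) (hp1 : p < 1) (hα : 1 ≤ α) :
    IsProbabilityMeasure (normalizedDeficiencyMeasure p α) :=
  ⟨(normalizedDeficiencyMeasure_apply hp0 hp1 hα).1⟩

theorem integrable_sq_normalizedDeficiencyMeasure (hp0 : 0 ≤ p) (hp1 : p < 1) (hα : 1 ≤ α) :
    Integrable (fun z => ‖z‖ ^ 2) (normalizedDeficiencyMeasure p α) := by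
  have := isProbabilityMeasure_normalizedDeficiencyMeasure hp0 hp1 hα
  have hsp : √p < 1 := by rw [Real.sqrt_lt' one_pos]; linarith
  refine Integrable.of_bound (Continuous.aestronglyMeasurable (by fun_prop)) α ?_
  filter_upwards [normalizedDeficiencyMeasure_ae_mem hα] with z hz
  rw [Real.norm_of_nonneg (by positivity)]
  have h1 := Real.one_le_sqrt.2 hα
  have h2 : ‖z‖ ≤ √α := hz.elim (fun h => by linarith) fun h => h.2
  exact (Real.le_sqrt (norm_nonneg z) (by linarith)).1 h2

theorem integrable_log_prod_normalizedDeficiencyMeasure (hp0 : 0 ≤ p) (hp1 : p < 1) (hα : 1 ≤ α)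
    {ν : Measure ℂ} [IsProbabilityMeasure ν] (hν : Integrable (fun z => ‖z‖ ^ 2) ν) :
    Integrable (fun x => Real.log ‖x.1 - x.2‖) (ν.prod (normalizedDeficiencyMeasure p α)) := by
  have := isProbabilityMeasure_normalizedDeficiencyMeasure hp0 hp1 hα
  refine integrable_log_prod (integrable_norm_of_sq hν)
    (integrable_norm_of_sq (integrable_sq_normalizedDeficiencyMeasure hp0 hp1 hα))
    (fun z => (integral_normalizedDeficiencyMeasure_log hp1 hα z).1)
    (K := α⁻¹ * (2 * (√p + (√α - 1)))) fun z => ?_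
  rw [(integral_normalizedDeficiencyMeasure_log hp1 hα z).2]
  exact deficiencyPotential_lower hp1 hα z

theorem prod_normalizedDeficiencyMeasure_ae_ne (hp0 : 0 ≤ p) (hp1 : p < 1) (hα : 1 ≤ α)
    (ν : Measure ℂ) : ∀ᵐ x ∂(ν.prod (normalizedDeficiencyMeasure p α)), x.1 ≠ x.2 := by
  have := isProbabilityMeasure_normalizedDeficiencyMeasure hp0 hp1 hα
  have hm : MeasurableSet {x : ℂ × ℂ | x.1 ≠ x.2} :=
    (measurableSet_eq_fun measurable_fst measurable_snd).compl
  exact (Measure.ae_prod_iff_ae_ae hm).2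
    (Eventually.of_forall fun z => normalizedDeficiencyMeasure_ae_ne z)

theorem integral_potential_bound (p α : ℝ)
    {ν : Measure ℂ} [IsProbabilityMeasure ν] (hν : Integrable (fun z => ‖z‖ ^ 2) ν) :
    Integrable (fun z : ℂ => ‖z‖ ^ 2 / (2 * α) + (Real.log α - 1) / 2 +
        {z : ℂ | ‖z‖ < 1}.indicator (fun _ => potentialGap p α) z) ν ∧
    ∫ z : ℂ, (‖z‖ ^ 2 / (2 * α) + (Real.log α - 1) / 2 +
        {z : ℂ | ‖z‖ < 1}.indicator (fun _ => potentialGap p α) z) ∂ν =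
      (∫ z, ‖z‖ ^ 2 ∂ν) / (2 * α) + (Real.log α - 1) / 2 +
        ν.real {z : ℂ | ‖z‖ < 1} * potentialGap p α := by
  have hD : MeasurableSet {z : ℂ | ‖z‖ < 1} := measurableSet_lt measurable_norm measurable_const
  have i1 : Integrable (fun z : ℂ => ‖z‖ ^ 2 / (2 * α) + (Real.log α - 1) / 2) ν :=
    (hν.div_const _).add (integrable_const _)
  have i2 : Integrable ({z : ℂ | ‖z‖ < 1}.indicator (fun _ => potentialGap p α)) ν :=
    (integrable_const _).indicator hD
  refine ⟨i1.add i2, ?_⟩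
  rw [integral_add i1 i2, integral_add (hν.div_const _) (integrable_const _), integral_div,
    integral_indicator_const _ hD]
  simp

theorem integral_deficiencyPotential (hp0 : 0 ≤ p) (hp1 : p < 1) (hα : 1 ≤ α)
    {ν : Measure ℂ} [IsProbabilityMeasure ν] (hν : Integrable (fun z => ‖z‖ ^ 2) ν) :
    Integrable (deficiencyPotential p α) ν ∧
    ∫ x, Real.log ‖x.1 - x.2‖ ∂(ν.prod (normalizedDeficiencyMeasure p α)) =
      ∫ z, deficiencyPotential p α z ∂ν := by
  have := isProbabilityMeasure_normalizedDeficiencyMeasure hp0 hp1 hα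
  have hi := integrable_log_prod_normalizedDeficiencyMeasure hp0 hp1 hα hν
  have he := fun z => (integral_normalizedDeficiencyMeasure_log hp1 hα (p := p) z).2
  constructor
  · exact hi.integral_prod_left.congr (Eventually.of_forall he)
  · rw [integral_prod _ hi]
    exact integral_congr_ae (Eventually.of_forall he)

theorem weightedEnergy_normalizedDeficiencyMeasure (hp0 : 0 ≤ p) (hp1 : p < 1) (hα : 1 ≤ α) :
    weightedEnergy α (normalizedDeficiencyMeasure p α) =
      (((∫ z, ‖z‖ ^ 2 ∂(normalizedDeficiencyMeasure p α)) / α -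
        ∫ x, Real.log ‖x.1 - x.2‖
          ∂((normalizedDeficiencyMeasure p α).prod (normalizedDeficiencyMeasure p α)) : ℝ) : EReal) := by
  have := isProbabilityMeasure_normalizedDeficiencyMeasure hp0 hp1 hα
  have hsq := integrable_sq_normalizedDeficiencyMeasure hp0 hp1 hα
  exact weightedEnergy_eq_coe (by linarith) hsq (prod_normalizedDeficiencyMeasure_ae_ne hp0 hp1 hα _)
    (integrable_log_prod_normalizedDeficiencyMeasure hp0 hp1 hα hsq)

theorem weightedEnergy_lt (hp0 : 0 ≤ p) (hp1 : p < 1) (hα : 1 ≤ α) {ν : Measure ℂ}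
    (hν : ν ∈ deficiencySet p α) (hne : ν ≠ normalizedDeficiencyMeasure p α) :
    weightedEnergy α (normalizedDeficiencyMeasure p α) < weightedEnergy α ν := by
  have hα0 : 0 < α := by linarith
  have hμ := isProbabilityMeasure_normalizedDeficiencyMeasure hp0 hp1 hα
  obtain ⟨hνp, hνD⟩ := hν
  rw [weightedEnergy_normalizedDeficiencyMeasure hp0 hp1 hα]
  rcases weightedEnergy_eq_top_or (ν := ν) hα0 with h | ⟨hsq, hnd, hlog⟩
  · rw [h]; exact EReal.coe_lt_top _
  rw [weightedEnergy_eq_coe hα0 hsq hnd hlog, EReal.coe_lt_coe_iff]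
  have hsqμ := integrable_sq_normalizedDeficiencyMeasure hp0 hp1 hα
  have hE := log_energy_lt hne hnd (prod_normalizedDeficiencyMeasure_ae_ne hp0 hp1 hα _)
    (prod_normalizedDeficiencyMeasure_ae_ne hp0 hp1 hα _) hlog
    (integrable_log_prod_normalizedDeficiencyMeasure hp0 hp1 hα hsqμ)
    (integrable_log_prod_normalizedDeficiencyMeasure hp0 hp1 hα hsq)
  obtain ⟨a1, a2⟩ := integral_deficiencyPotential hp0 hp1 hα hsq
  obtain ⟨-, b2⟩ := integral_deficiencyPotential hp0 hp1 hα hsqμ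
  obtain ⟨c1, c2⟩ := integral_potential_bound p α hsq
  obtain ⟨-, d2⟩ := integral_potential_bound p α hsqμ
  have hle := integral_mono a1 c1 (deficiencyPotential_le hp0 hp1 hα)
  have heq := integral_congr_ae (deficiencyPotential_ae_eq hp0 hp1 hα)
  have hD : ν.real {z : ℂ | ‖z‖ < 1} ≤ p / α := ENNReal.toReal_le_of_le_ofReal (by positivity) hνD
  have hDμ : (normalizedDeficiencyMeasure p α).real {z : ℂ | ‖z‖ < 1} = p / α := by
    rw [measureReal_def, (normalizedDeficiencyMeasure_apply hp0 hp1 hα).2,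
      ENNReal.toReal_ofReal (by positivity)]
  -- Here the constraint on ν enters: the sign of c₁ turns less mass in D into a smaller bound for ∫
  -- U dν.
  have hgap := mul_le_mul_of_nonneg_right hD (potentialGap_pos hp0 hp1 hα).le
  have hhalf : ∀ x : ℝ, x / (2 * α) = x / α / 2 := fun x => by field_simp
  rw [c2, hhalf] at hle
  rw [d2, hDμ, hhalf] at heq
  -- By Fubini the mutual energy and the self-energy of the candidate become integrals of its
  -- potential; the rest is the linear combination of `hE`, `hle`, `heq` and `hgap`.
  rw [b2, a2] at hE
  rw [b2]
  linarith

theorem logPotential_normalizedDeficiencyMeasure (hp1 : p < 1) (hα : 1 ≤ α) (z : ℂ) :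
    logPotential (normalizedDeficiencyMeasure p α) z = (deficiencyPotential p α z : EReal) := by
  obtain ⟨h1, h2⟩ := integral_normalizedDeficiencyMeasure_log hp1 hα z
  rw [logPotential, eintegral_eq_coe h1
    ((normalizedDeficiencyMeasure_ae_ne z).mono fun w hw => logKernel_of_ne hw), h2]

end Minimizer

end Ginibre

theorem mainTheorem4 (p α : ℝ) (hp0 : 0 ≤ p) (hp1 : p < 1) (hα : 1 ≤ α) :
    -- the normalized measure is a probability measure lying in the constraint set
    Ginibre.normalizedDeficiencyMeasure p α ∈ Ginibre.deficiencySet p α ∧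
    -- its energy is a finite real number
    (∃ c : ℝ, Ginibre.weightedEnergy α (Ginibre.normalizedDeficiencyMeasure p α) = (c : EReal)) ∧
    -- it is the unique minimizer
    (∀ ν ∈ Ginibre.deficiencySet p α, ν ≠ Ginibre.normalizedDeficiencyMeasure p α →
      Ginibre.weightedEnergy α (Ginibre.normalizedDeficiencyMeasure p α) <
        Ginibre.weightedEnergy α ν) ∧
    -- its logarithmic potential: equality on the support, strict inequality off it
    0 < Ginibre.potentialGap p α ∧
    (∀ z : ℂ, ‖z‖ ≤ √p →
      Ginibre.logPotential (Ginibre.normalizedDeficiencyMeasure p α) z =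
        ((‖z‖ ^ 2 / (2 * α) + (Real.log α - 1) / 2 + Ginibre.potentialGap p α : ℝ) : EReal)) ∧
    (∀ z : ℂ, 1 ≤ ‖z‖ → ‖z‖ ≤ √α →
      Ginibre.logPotential (Ginibre.normalizedDeficiencyMeasure p α) z =
        ((‖z‖ ^ 2 / (2 * α) + (Real.log α - 1) / 2 : ℝ) : EReal)) ∧
    (∀ z : ℂ, √p < ‖z‖ → ‖z‖ < 1 →
      Ginibre.logPotential (Ginibre.normalizedDeficiencyMeasure p α) z <
        ((‖z‖ ^ 2 / (2 * α) + (Real.log α - 1) / 2 + Ginibre.potentialGap p α : ℝ) : EReal)) ∧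
    (∀ z : ℂ, √α < ‖z‖ →
      Ginibre.logPotential (Ginibre.normalizedDeficiencyMeasure p α) z <
        ((‖z‖ ^ 2 / (2 * α) + (Real.log α - 1) / 2 : ℝ) : EReal)) := by

  have hU := fun z => Ginibre.logPotential_normalizedDeficiencyMeasure hp1 hα (p := p) z
  refine ⟨⟨Ginibre.isProbabilityMeasure_normalizedDeficiencyMeasure hp0 hp1 hα,
      (Ginibre.normalizedDeficiencyMeasure_apply hp0 hp1 hα).2.le⟩,
    ⟨_, Ginibre.weightedEnergy_normalizedDeficiencyMeasure hp0 hp1 hα⟩,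
    fun ν hν hne => Ginibre.weightedEnergy_lt hp0 hp1 hα hν hne,
    Ginibre.potentialGap_pos hp0 hp1 hα, fun z hz => ?_, fun z hz hz2 => ?_,
    fun z hz hz2 => ?_, fun z hz => ?_⟩
  · rw [hU, Ginibre.deficiencyPotential_of_le_sqrt hp0 hp1 hα hz]
  · rw [hU, Ginibre.deficiencyPotential_of_mem_annulus hp0 hp1 hα hz hz2]
  · rw [hU, EReal.coe_lt_coe_iff]
    exact Ginibre.deficiencyPotential_lt_of_gap hp0 hα hz hz2
  · rw [hU, EReal.coe_lt_coe_iff]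
    exact Ginibre.deficiencyPotential_lt_of_sqrt_lt hp0 hp1 hα hz
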